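/- **Setting.** Let $1\le L\le K$. In an environment with $K$ arms, the reward vectors $(x_i(t))_{i\in[K]}\in[0,1]^K$ of the rounds $t=1,2,\dots$ are independent over $t$, with means $\mu_{i,t}=\mathbb E[x_i(t)]$. A (randomized, history-dependent) bandit algorithm plays in each round a set $I(t)\subseteq[K]$ with $|I(t)|=L$ and observes $(x_i(t))_{i\in I(t)}$. Its regret is $\mathrm{Reg}(S)=\sum_{t=1}^S\bigl(\max_{|J|=L}\sum_{i\in J}\mu_{i,t}-\sum_{i\in I(t)}\mu_{i,t}\bigr)$. **ADR-bandit.** Given a base algorithm and $\delta\in(0,1)$, the ADR-bandit plays the base algorithm on the window $W$ of the observations made since the last reset. After each round (whose observation is appended to $W$) it resets, i.e. empties $W$ and restarts the base algorithm from scratch, if for some arm $i$ and some split of $W$ into consecutive subwindows $W_1,W_2$ containing $n_1,n_2\ge1$ observations of arm $i$, with empirical means $\hat\mu_{i,W_1},\hat\mu_{i,W_2}$, $$|\hat\mu_{i,W_1}-\hat\mu_{i,W_2}|\ \ge\ \sqrt{\tfrac{1}{2n_1}\log\tfrac1\delta}+\sqrt{\tfrac{1}{2n_2}\log\tfrac1\delta}.$$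 **Assumptions on the base algorithm**, for a horizon $T$ (which it may know). (i) *Sublinear drift-tolerant regret with factor $C^{\mathrm{dr}}$*: run alone in any environment, for every $1\le S\le T$, $$\mathbb E[\mathrm{Reg}(S)]\le C^{\mathrm{dr}}\Bigl(\sqrt{LKS}+L\sum_{t=1}^S\epsilon(t)\Bigr),\qquad \epsilon(t)=\sum_{1\le s<t}\max_i|\mu_{i,s}-\mu_{i,s+1}|.$$ (ii) *Monitoring consistency with parameter $D$*: run alone in any environment, almost surely there is an arm that is played at least once in every block of $D$ consecutive rounds of $\{1,\dots,T\}$. **Globally abrupt changes.** Let $T_1<\dots<T_M$ be the rounds $1\le t<T$ with $\mu_{i,t}\ne\mu_{i,t+1}$ for some $i$, let $T_0=0$, $T_{M+1}=T$, $\epsilon_m=\min_i|\mu_{i,T_m}-\mu_{i,T_m+1}|$ and $U(\epsilon)=\log(T^3)/(2\epsilon^2)$. The environment has $M$ globally abrupt changes with ratio bound $C^{\mathrm{ab}}$ if $T_m-T_{m-1}\ge 32DU(\epsilon_m)$ and $T_{m+1}-T_m\ge 32DU(\epsilon_m)$ for $m=1,\dots,M$, and if, at every changepoint $t$ and for all arms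 $i,j$, $|\mu_{i,t}-\mu_{i,t+1}|\neq0$ and $|\mu_{j,t}-\mu_{j,t+1}|\,/\,|\mu_{i,t}-\mu_{i,t+1}|\le C^{\mathrm{ab}}$. **Theorem (Regret bound of ADR-bandit under abrupt changes).** For all constants $C^{\mathrm{ab}}$, $c_0$ and $p\in\mathbb N$ there are constants $c$ and $q\in\mathbb N$, depending only on these, such that the following holds for all $T$, $K$, $L$, $D$ and all $M\ge1$. If the base algorithm has sublinear drift-tolerant regret with factor $C^{\mathrm{dr}}=c_0(1+\log T)^p$ and monitoring consistency with parameter $D$, and the environment has $M$ globally abrupt changes with ratio bound $C^{\mathrm{ab}}$, then the regret of the ADR-bandit with $\delta=1/T^3$ is integrable and $$\mathbb E[\mathrm{Reg}(T)]\ \le\ c\,(1+\log T)^q\,\sqrt{\kappa}\,\sqrt{MLKT},\qquad \kappa=\max\Bigl\{1,\frac{LD}{K},\frac{LK}{T}\Bigr\}.$$ In particular, with $K$, $L$, $D$ and $C^{\mathrm{ab}}$ regarded as constants (or as long as $LD=O(K)$ and $LK=O(T)$), $\mathbb E[\mathrm{Reg}(T)]=\tilde O(\sqrt{MLKT})$.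 -/

import Mathlib

open MeasureTheory

noncomputable section

namespace Bandit

/-! ### Environments -/

/-- A multiple-play bandit environment with `K` reward streams. `law t` is the joint law of the
reward vector `(x_i(t))_i ∈ [0,1]^K` of round `t = 1, 2, …`; the reward vectors of different rounds
are independent (see `runMeasure`). The entry `law 0` plays no role. -/
structure Environment (K : ℕ) where
  law : ℕ → Measure (Fin K → ℝ)
  isProbabilityMeasure_law : ∀ t, IsProbabilityMeasure (law t)
  reward_mem_Icc : ∀ t, ∀ᵐ x ∂(law t), ∀ i, x i ∈ Set.Icc (0 : ℝ) 1

variable {K : ℕ}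

/-- The mean `μ_{i,t}`. -/
def Environment.mean (env : Environment K) (i : Fin K) (t : ℕ) : ℝ :=
  ∫ x, x i ∂(env.law t)

/-- `|μ_{i,t} - μ_{i,t+1}|`. -/
def Environment.jump (env : Environment K) (i : Fin K) (t : ℕ) : ℝ :=
  |env.mean i t - env.mean i (t + 1)|

/-- The accumulated drift `ε(t) = ∑_{1 ≤ s < t} max_i |μ_{i,s} - μ_{i,s+1}|`. -/
def Environment.drift (env : Environment K) (t : ℕ) : ℝ :=
  ∑ s ∈ Finset.Ico 1 t, ⨆ i, env.jump i s

/-! ### Bandit algorithms and their runs -/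

/-- What the forecaster sees in one round: the set of played arms, and their rewards (with the
entries of the arms that were not played masked by `0`). -/
abbrev Obs (K : ℕ) : Type := Finset (Fin K) × (Fin K → ℝ)

/-- A randomized, history-dependent rule: from the list of past observations (oldest first)
and a fresh random seed, uniform on `[0,1]`, it produces the set of arms to be played. -/
abbrev Strategy (K : ℕ) : Type := List (Obs K) → unitInterval → Finset (Fin K)

/-- `alg` is a bandit algorithm that plays `L` arms per round (measurably). -/
structure IsBanditAlgorithm (L : ℕ) (alg : Strategy K) : Prop where
  card_eq : ∀ h u, (alg h u).card = L
  measurable : ∀ n : ℕ,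
    Measurable fun p : (Fin n → Obs K) × unitInterval => alg (List.ofFn p.1) p.2

/-- Sample points: for every round, a seed and the full reward vector of that round. -/
abbrev Sample (K : ℕ) : Type := ℕ → unitInterval × (Fin K → ℝ)

/-- The law of seeds and rewards: everything is independent over the rounds, and the seeds are
uniform and independent of the rewards. -/
def runMeasure (env : Environment K) : Measure (Sample K) :=
  Measure.infinitePi fun t => (volume : Measure unitInterval).prod (env.law t)

/-- Bandit feedback: only the rewards of the played arms are revealed. -/
def observe (I : Finset (Fin K)) (x : Fin K → ℝ) : Obs K :=
  (I, fun i => if i ∈ I then x i else 0)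

/-- The observations of rounds `1, …, t`, oldest first. -/
def history (alg : Strategy K) (ω : Sample K) : ℕ → List (Obs K)
  | 0 => []
  | t + 1 => history alg ω t ++
      [observe (alg (history alg ω t) (ω (t + 1)).1) (ω (t + 1)).2]

/-- The set `I(t)` of arms played in round `t ≥ 1`. -/
def played (alg : Strategy K) (ω : Sample K) (t : ℕ) : Finset (Fin K) :=
  alg (history alg ω (t - 1)) (ω t).1

/-- `reg(t) = max_{|J| = L} ∑_{i ∈ J} μ_{i,t} - ∑_{i ∈ I} μ_{i,t}`. -/
def instantRegret (env : Environment K) (L t : ℕ) (I : Finset (Fin K)) : ℝ :=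
  (⨆ J : {J : Finset (Fin K) // J.card = L}, ∑ i ∈ J.1, env.mean i t) - ∑ i ∈ I, env.mean i t

/-- `Reg(S) = ∑_{t=1}^S reg(t)`, a random variable. -/
def regret (env : Environment K) (L : ℕ) (alg : Strategy K) (S : ℕ) (ω : Sample K) : ℝ :=
  ∑ t ∈ Finset.Icc 1 S, instantRegret env L t (played alg ω t)

/-- `E[Reg(S)]`. -/
def expectedRegret (env : Environment K) (L : ℕ) (alg : Strategy K) (S : ℕ) : ℝ :=
  ∫ ω, regret env L alg S ω ∂(runMeasure env)

/-! ### The ADR-bandit -/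

/-- The number of observations of arm `i` in the window `W`. -/
def count (i : Fin K) (W : List (Obs K)) : ℕ :=
  (W.filter fun o => i ∈ o.1).length

/-- The empirical mean of the observations of arm `i` in the window `W`. -/
def empMean (i : Fin K) (W : List (Obs K)) : ℝ :=
  ((W.filter fun o => i ∈ o.1).map fun o => o.2 i).sum / count i W

/-- The threshold `ε_cut^δ` for two subwindows with `n₁` and `n₂` observations. -/
def cutThreshold (δ : ℝ) (n₁ n₂ : ℕ) : ℝ :=
  Real.sqrt (1 / (2 * n₁) * Real.log (1 / δ)) + Real.sqrt (1 / (2 * n₂) * Real.log (1 / δ))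

/-- A change is detected in the window `W` if, for some arm `i` and some split `W = W₁ ∪ W₂` into
consecutive subwindows, the empirical means of arm `i` differ by at least the threshold. (The
threshold is infinite if one of the subwindows has no observation of arm `i`.) -/
def Detects (δ : ℝ) (W : List (Obs K)) : Prop :=
  ∃ (i : Fin K) (m : ℕ), 0 < count i (W.take m) ∧ 0 < count i (W.drop m) ∧
    cutThreshold δ (count i (W.take m)) (count i (W.drop m)) ≤
      |empMean i (W.take m) - empMean i (W.drop m)|

open Classical in
/-- The current window: it is extended by each new observation, and emptied upon a detection. -/
def window (δ : ℝ) (h : List (Obs K)) : List (Obs K) :=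
  h.foldl (fun W o => if Detects δ (W ++ [o]) then [] else W ++ [o]) []

/-- The ADR-bandit with confidence level `δ`: it runs the base algorithm on the current window, that
is, the base algorithm is restarted from scratch at each detection. -/
def adrBandit (δ : ℝ) (base : Strategy K) : Strategy K :=
  fun h u => base (window δ h) u

/-! ### The assumptions -/

/-- Drift-tolerant regret with factor `C` over the first `T` rounds: in every environment and for
every `S ≤ T`, `E[Reg(S)] ≤ C (√(LKS) + L ∑_{t ≤ S} ε(t))`. -/
def HasDTRegret (L T : ℕ) (C : ℝ) (base : Strategy K) : Prop :=
  ∀ env : Environment K, ∀ S ∈ Finset.Icc 1 T,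
    expectedRegret env L base S ≤
      C * (Real.sqrt (L * K * S) + L * ∑ t ∈ Finset.Icc 1 S, env.drift t)

/-- Monitoring consistency with parameter `D` over `T` rounds: in every environment, almost surely
there is an arm that is played in each block of `D` consecutive rounds in `{1, …, T}`. -/
def MonitoringConsistent (T D : ℕ) (base : Strategy K) : Prop :=
  ∀ env : Environment K, ∀ᵐ ω ∂(runMeasure env),
    ∃ i : Fin K, ∀ t, 1 ≤ t → t + D ≤ T + 1 → ∃ t' ∈ Finset.Ico t (t + D), i ∈ played base ω t'

/-- The changepoints `t ∈ {1, …, T - 1}`: `μ_{i,t} ≠ μ_{i,t+1}` for some arm `i`. -/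
def changepoints (env : Environment K) (T : ℕ) : Set ℕ :=
  {t | 1 ≤ t ∧ t < T ∧ ∃ i, env.mean i t ≠ env.mean i (t + 1)}

/-- `U(ε) = log(T³) / (2 ε²)`. -/
def detectionSize (T : ℕ) (ε : ℝ) : ℝ :=
  Real.log ((T : ℝ) ^ 3) / (2 * ε ^ 2)

/-- The environment has exactly `M` changepoints `T_1 < … < T_M` in the horizon `T`, all of them
global changes with respect to `D`, and the ratio of the changes of any two arms at any changepoint
is finite and at most `Cab`. Here `(T_0, T_{M+1}) = (0, T)`. -/
structure GloballyAbrupt (env : Environment K) (T D M : ℕ) (Cab : ℝ) : Prop where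
  exists_enumeration : ∃ τ : ℕ → ℕ,
    τ 0 = 0 ∧ τ (M + 1) = T ∧ StrictMonoOn τ (Set.Icc 0 (M + 1)) ∧
    τ '' Set.Icc 1 M = changepoints env T ∧
    ∀ m ∈ Set.Icc 1 M,
      32 * D * detectionSize T (⨅ i, env.jump i (τ m)) ≤ (τ m : ℝ) - τ (m - 1) ∧
      32 * D * detectionSize T (⨅ i, env.jump i (τ m)) ≤ (τ (m + 1) : ℝ) - τ m
  ratio_le : ∀ t ∈ changepoints env T, ∀ i j,
    env.jump i t ≠ 0 ∧ env.jump j t / env.jump i t ≤ Cab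

end Bandit

end

open MeasureTheory

noncomputable section

namespace Bandit

variable {K : ℕ}

/-! ### Histories and measurability -/

/-! Write `l = log T³` and let `e m` be the smallest jump at the changepoint `τ m`. Hoeffding's
inequality for the numbered observations of each arm, with a union bound, shows that outside an
event of probability at most `2KT² exp(-(l-1)) = 2eK/T` all empirical means over windows up to `T`
are accurate (`exists_concentrated`). There, a window without a changepoint raises no alarm.
Conversely, once the monitored arm has about `16 U(e m)` observations on each side of `τ m`, its
change exceeds the threshold. Since every arm jumps by at least `e m`, it does not matter which arm
is monitored. So the `m`-th change causes a reset within `D * N m` rounds, where `N m = ⌈16 U(e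
m)⌉`, and the gap condition makes this happen before the next change (`exists_phase`).

Hence each round lies in a phase that starts at the first reset `r` after `τ m` (at `r = 0` for `m =
0`) and ends by the deadline `τ (m+1) + D * N (m+1)`. Within it the ADR-bandit is the base algorithm
run on the shifted sample. Regret being nonnegative, the phase may be prolonged up to the deadline,
so only its start is random (`regret_le_sum_phases`). The event "the first reset is at `r`" depends
on the rounds up to `r`, the fresh run on later ones. By independence the expectation factorises;
the events are disjoint in `r`, so the phase costs at most a bound uniform in `r`
(`expectedRegret_adrBandit_le`).

That bound is the drift-tolerant regret of an environment with at most one change, which drifts only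
for the last `D * N (m+1)` rounds. With `Δ = τ (m+1) - τ m`, the length is at most `2Δ`. The
accumulated drift is at most `Cab * D * N * e`, of order `Cab * D * l / e`; since `Δ ≥ 32DU = 16 D l
/ e²`, this is `O(Cab √(D l Δ))` (`exists_schedule`). Summing `√Δ` over the phases by Cauchy–Schwarz
gives `√(MT)`. In `κ`, the entry `LD/K` absorbs the drift term and `LK/T` the exceptional event. -/

instance (env : Environment K) (t : ℕ) : IsProbabilityMeasure (env.law t) :=
  env.isProbabilityMeasure_law t

instance (env : Environment K) : IsProbabilityMeasure (runMeasure env) := by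
  unfold runMeasure; infer_instance

/-- The observation of round `t`. -/
def obsAt (alg : Strategy K) (ω : Sample K) (t : ℕ) : Obs K :=
  observe (played alg ω t) (ω t).2

theorem history_succ (alg : Strategy K) (ω : Sample K) (t : ℕ) :
    history alg ω (t + 1) = history alg ω t ++ [obsAt alg ω (t + 1)] := rfl

theorem history_eq_ofFn (alg : Strategy K) (ω : Sample K) (t : ℕ) :
    history alg ω t = List.ofFn fun k : Fin t => obsAt alg ω (k + 1) := by
  induction t with
  | zero => simp [history]
  | succ t ih => rw [history_succ, ih, List.ofFn_succ_last]; simp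

theorem measurable_observe :
    Measurable fun p : Finset (Fin K) × (Fin K → ℝ) => observe p.1 p.2 := by
  refine measurable_fst.prodMk (measurable_pi_lambda _ fun i => ?_)
  refine Measurable.ite ?_ (by fun_prop) measurable_const
  exact measurable_fst (MeasurableSet.of_discrete (s := {I : Finset (Fin K) | i ∈ I}))

theorem measurable_played {L : ℕ} {alg : Strategy K} (h : IsBanditAlgorithm L alg) (t : ℕ) :
    Measurable fun ω => played alg ω t := by
  induction t using Nat.strong_induction_on with
  | _ t ih =>
    have : (fun ω => played alg ω t) = (fun p : (Fin (t - 1) → Obs K) × unitInterval =>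
        alg (List.ofFn p.1) p.2) ∘ fun ω => (fun k : Fin (t - 1) => obsAt alg ω (k + 1),
          (ω t).1) := by
      funext ω; simp [played, history_eq_ofFn]
    rw [this]
    refine (h.measurable _).comp (Measurable.prodMk (measurable_pi_lambda _ fun k => ?_)
      (by fun_prop))
    exact measurable_observe.comp ((ih _ (by omega)).prodMk (by fun_prop))

theorem measurable_obsAt {L : ℕ} {alg : Strategy K} (h : IsBanditAlgorithm L alg) (t : ℕ) :
    Measurable fun ω => obsAt alg ω t :=
  measurable_observe.comp ((measurable_played h t).prodMk (by fun_prop))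

theorem count_eq_sum (i : Fin K) (W : List (Obs K)) :
    count i W = (W.map fun o => if i ∈ o.1 then 1 else 0).sum := by
  unfold count
  induction W with
  | nil => simp
  | cons o W ih => by_cases h : i ∈ o.1 <;> simp_all [add_comm]

theorem empMean_eq_sum (i : Fin K) (W : List (Obs K)) :
    empMean i W = (W.map fun o => if i ∈ o.1 then o.2 i else 0).sum / count i W := by
  unfold empMean
  congr 1
  induction W with
  | nil => simp
  | cons o W ih => by_cases h : i ∈ o.1 <;> simp_all

theorem drop_ofFn {α : Type*} {n : ℕ} (v : Fin n → α) (m k : ℕ) (h : m + k = n) :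
    (List.ofFn v).drop m = List.ofFn fun j : Fin k => v ⟨m + j, by omega⟩ := by
  apply List.ext_getElem
  · simp; omega
  · intro j h1 h2; simp

theorem measurable_sum_take {β : Type*} [AddCommMonoid β] [MeasurableSpace β] [MeasurableAdd₂ β]
    {g : Obs K → β} (hg : Measurable g) (n m : ℕ) :
    Measurable fun v : Fin n → Obs K => (((List.ofFn v).take m).map g).sum := by
  simp_rw [List.map_take, List.map_ofFn, List.sum_take_ofFn]
  exact Finset.measurable_fun_sum _ fun j _ => hg.comp (measurable_pi_apply j)

theorem measurable_sum_drop {β : Type*} [AddCommMonoid β] [MeasurableSpace β] [MeasurableAdd₂ β]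
    {g : Obs K → β} (hg : Measurable g) (n m : ℕ) :
    Measurable fun v : Fin n → Obs K => (((List.ofFn v).drop m).map g).sum := by
  rcases le_or_gt m n with h | h
  · obtain ⟨k, rfl⟩ := Nat.exists_eq_add_of_le h
    simp_rw [fun v : Fin (m + k) → Obs K => drop_ofFn v m k rfl, List.map_ofFn, List.sum_ofFn]
    exact Finset.measurable_fun_sum _ fun j _ => hg.comp (measurable_pi_apply _)
  · have : ∀ v : Fin n → Obs K, (List.ofFn v).drop m = [] := fun v =>
      List.drop_eq_nil_of_le (by simp; omega)
    simp [this]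

theorem measurableSet_mem_fst (i : Fin K) : MeasurableSet {o : Obs K | i ∈ o.1} :=
  measurable_fst (MeasurableSet.of_discrete (s := {I : Finset (Fin K) | i ∈ I}))

theorem measurableSet_detects (δ : ℝ) (n : ℕ) :
    MeasurableSet {v : Fin n → Obs K | Detects δ (List.ofFn v)} := by
  have h1 : ∀ i : Fin K, Measurable fun o : Obs K => if i ∈ o.1 then (1 : ℕ) else 0 := fun i =>
    Measurable.ite (measurableSet_mem_fst i) measurable_const measurable_const
  have h2 : ∀ i : Fin K, Measurable fun o : Obs K => if i ∈ o.1 then o.2 i else 0 := fun i =>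
    Measurable.ite (measurableSet_mem_fst i) (by fun_prop) measurable_const
  have c1 : ∀ i m, Measurable fun v : Fin n → Obs K => count i ((List.ofFn v).take m) := by
    intro i m; simp_rw [count_eq_sum]; exact measurable_sum_take (h1 i) n m
  have c2 : ∀ i m, Measurable fun v : Fin n → Obs K => count i ((List.ofFn v).drop m) := by
    intro i m; simp_rw [count_eq_sum]; exact measurable_sum_drop (h1 i) n m
  have e1 : ∀ i m, Measurable fun v : Fin n → Obs K => empMean i ((List.ofFn v).take m) := by
    intro i m; simp_rw [empMean_eq_sum]
    exact (measurable_sum_take (h2 i) n m).div (measurable_from_top.comp (c1 i m))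
  have e2 : ∀ i m, Measurable fun v : Fin n → Obs K => empMean i ((List.ofFn v).drop m) := by
    intro i m; simp_rw [empMean_eq_sum]
    exact (measurable_sum_drop (h2 i) n m).div (measurable_from_top.comp (c2 i m))
  have ht : ∀ i m, Measurable fun v : Fin n → Obs K =>
      cutThreshold δ (count i ((List.ofFn v).take m)) (count i ((List.ofFn v).drop m)) := by
    intro i m
    have s : ∀ {f : (Fin n → Obs K) → ℕ}, Measurable f →
        Measurable fun v => Real.sqrt (1 / (2 * f v) * Real.log (1 / δ)) := fun hf =>
      (Measurable.of_discrete (f := fun a : ℕ =>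
        Real.sqrt (1 / (2 * a) * Real.log (1 / δ)))).comp hf
    exact (s (c1 i m)).add (s (c2 i m))
  have hm : ∀ i m, MeasurableSet {v : Fin n → Obs K | 0 < count i ((List.ofFn v).take m) ∧
      0 < count i ((List.ofFn v).drop m) ∧
      cutThreshold δ (count i ((List.ofFn v).take m)) (count i ((List.ofFn v).drop m)) ≤
      |empMean i ((List.ofFn v).take m) - empMean i ((List.ofFn v).drop m)|} := by
    intro i m
    have h1 : MeasurableSet {v : Fin n → Obs K | 0 < count i ((List.ofFn v).take m)} :=
      c1 i m (MeasurableSet.of_discrete (s := Set.Ioi 0))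
    have h2 : MeasurableSet {v : Fin n → Obs K | 0 < count i ((List.ofFn v).drop m)} :=
      c2 i m (MeasurableSet.of_discrete (s := Set.Ioi 0))
    have h3 : MeasurableSet {v : Fin n → Obs K |
        cutThreshold δ (count i ((List.ofFn v).take m)) (count i ((List.ofFn v).drop m)) ≤
        |empMean i ((List.ofFn v).take m) - empMean i ((List.ofFn v).drop m)|} :=
      measurableSet_le (ht i m) (((e1 i m).sub (e2 i m)).abs)
    exact h1.inter (h2.inter h3)
  have : {v : Fin n → Obs K | Detects δ (List.ofFn v)} = ⋃ i : Fin K, ⋃ m : ℕ,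
      {v : Fin n → Obs K | 0 < count i ((List.ofFn v).take m) ∧
      0 < count i ((List.ofFn v).drop m) ∧
      cutThreshold δ (count i ((List.ofFn v).take m)) (count i ((List.ofFn v).drop m)) ≤
      |empMean i ((List.ofFn v).take m) - empMean i ((List.ofFn v).drop m)|} := by
    ext v; simp only [Set.mem_iUnion, Set.mem_ofPred_eq, Detects]
  rw [this]
  exact MeasurableSet.iUnion fun i => MeasurableSet.iUnion fun m => hm i m

theorem window_append_singleton (δ : ℝ) (h : List (Obs K)) (o : Obs K) :
    window δ (h ++ [o]) =
      open Classical in if Detects δ (window δ h ++ [o]) then [] else window δ h ++ [o] := by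
  simp only [window, List.foldl_append, List.foldl_cons, List.foldl_nil]
  congr

theorem window_length_le (δ : ℝ) (h : List (Obs K)) : (window δ h).length ≤ h.length := by
  induction h using List.reverseRecOn with
  | nil => simp [window]
  | append_singleton h o ih => rw [window_append_singleton]; split_ifs <;> simp_all

/-- The window is a suffix of the history, so its length determines it. Measurability of the
restarted algorithm thus reduces to finitely many lengths, for each of which the base algorithm is
measurable by assumption. -/
theorem window_eq_drop (δ : ℝ) (h : List (Obs K)) :
    window δ h = h.drop (h.length - (window δ h).length) := by
  induction h using List.reverseRecOn with
  | nil => simp [window]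
  | append_singleton h o ih =>
    rw [window_append_singleton]
    split_ifs
    · simp
    · have := window_length_le δ h
      rw [List.drop_append_of_le_length (by simp)]
      simpa using ih

theorem measurableSet_window_length (δ : ℝ) (n k : ℕ) :
    MeasurableSet {v : Fin n → Obs K | (window δ (List.ofFn v)).length = k} := by
  induction n generalizing k with
  | zero => simp [window]
  | succ n ih =>
    let A : ℕ → Set (Fin (n + 1) → Obs K) := fun j =>
      (fun v (l : Fin n) => v l.castSucc) ⁻¹' {v | (window δ (List.ofFn v)).length = j}
    let B : ℕ → Set (Fin (n + 1) → Obs K) := fun j =>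
      {v | Detects δ ((List.ofFn v).drop (n - j))}
    have hA : ∀ j, MeasurableSet (A j) := fun j => by
      refine measurableSet_preimage ?_ (ih j); fun_prop
    have hB : ∀ j ≤ n, MeasurableSet (B j) := fun j hj => by
      have : B j = (fun v (l : Fin (j + 1)) => v ⟨n - j + l, by omega⟩) ⁻¹'
          {v | Detects δ (List.ofFn v)} := by
        ext v; simp only [B, Set.mem_preimage, Set.mem_ofPred_eq]
        rw [drop_ofFn v (n - j) (j + 1) (by omega)]
      rw [this]
      refine measurableSet_preimage ?_ (measurableSet_detects δ _); fun_prop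
    have hw : ∀ v : Fin (n + 1) → Obs K, window δ (List.ofFn v) =
        open Classical in if Detects δ ((List.ofFn v).drop
          (n - (window δ (List.ofFn fun l : Fin n => v l.castSucc)).length)) then []
        else (List.ofFn v).drop
          (n - (window δ (List.ofFn fun l : Fin n => v l.castSucc)).length) := by
      intro v
      have h1 : window δ (List.ofFn fun l : Fin n => v l.castSucc) ++ [v (Fin.last n)] =
          (List.ofFn v).drop
          (n - (window δ (List.ofFn fun l : Fin n => v l.castSucc)).length) := by
        conv_lhs => rw [window_eq_drop]
        conv_rhs => rw [List.ofFn_succ_last]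
        rw [List.drop_append_of_le_length (by simp)]
        simp
      rw [← h1, ← window_append_singleton]
      congr 1
      exact List.ofFn_succ_last
    have hle : ∀ v : Fin (n + 1) → Obs K,
        (window δ (List.ofFn fun l : Fin n => v l.castSucc)).length ≤ n := fun v => by
      simpa using window_length_le δ (List.ofFn fun l : Fin n => v l.castSucc)
    have : {v : Fin (n + 1) → Obs K | (window δ (List.ofFn v)).length = k} =
        ⋃ j ∈ Finset.range (n + 1), A j ∩ {v | (v ∈ B j ∧ k = 0) ∨ (v ∉ B j ∧ k = j + 1)} := by
      ext v
      simp only [Set.mem_ofPred_eq, Set.mem_iUnion, Finset.mem_range, Set.mem_inter_iff, A, B,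
        Set.mem_preimage, exists_prop]
      have := hle v
      rw [hw v]
      constructor
      · intro h
        refine ⟨_, by omega, rfl, ?_⟩
        split_ifs at h with hd
        · exact Or.inl ⟨hd, by simpa using h.symm⟩
        · refine Or.inr ⟨hd, ?_⟩
          simp at h; omega
      · rintro ⟨j, hj, rfl, h | h⟩
        · rw [if_pos h.1, h.2]; rfl
        · rw [if_neg h.1, h.2]; simp; omega
    rw [this]
    refine Finset.measurableSet_biUnion _ fun j hj => (hA j).inter ?_
    have := hB j (by simpa [Nat.lt_succ_iff] using hj)
    exact (this.inter (MeasurableSet.const _)).union (this.compl.inter (MeasurableSet.const _))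

theorem IsBanditAlgorithm.adrBandit {L : ℕ} {base : Strategy K} (h : IsBanditAlgorithm L base)
    (δ : ℝ) : IsBanditAlgorithm L (adrBandit δ base) where
  card_eq _ _ := h.card_eq _ _
  measurable n := by
    intro S hS
    have : (fun p : (Fin n → Obs K) × unitInterval =>
        Bandit.adrBandit δ base (List.ofFn p.1) p.2) ⁻¹' S = ⋃ k ∈ Finset.range (n + 1),
        {p | (window δ (List.ofFn p.1)).length = k} ∩
          {p | base ((List.ofFn p.1).drop (n - k)) p.2 ∈ S} := by
      ext p
      simp only [Set.mem_preimage, Set.mem_iUnion, Finset.mem_range, Set.mem_inter_iff,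
        Set.mem_ofPred_eq, exists_prop, Bandit.adrBandit]
      have h1 := window_length_le δ (List.ofFn p.1)
      have h2 := window_eq_drop δ (List.ofFn p.1)
      simp only [List.length_ofFn] at h1 h2
      constructor
      · intro hp
        exact ⟨_, by omega, rfl, h2 ▸ hp⟩
      · rintro ⟨k, hk, rfl, hp⟩
        rwa [h2]
    rw [this]
    refine Finset.measurableSet_biUnion _ fun k hk => MeasurableSet.inter ?_ ?_
    · exact measurable_fst (measurableSet_window_length δ n k)
    · have hk' : k ≤ n := by simpa [Nat.lt_succ_iff] using hk
      have : {p : (Fin n → Obs K) × unitInterval | base ((List.ofFn p.1).drop (n - k)) p.2 ∈ S} =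
          (fun p => ((fun l : Fin k => p.1 ⟨n - k + l, by omega⟩ : Fin k → Obs K), p.2)) ⁻¹'
          ((fun p : (Fin k → Obs K) × unitInterval => base (List.ofFn p.1) p.2) ⁻¹' S) := by
        ext p; simp only [Set.mem_preimage, Set.mem_ofPred_eq]
        rw [drop_ofFn p.1 (n - k) k (by omega)]
      rw [this]
      exact measurableSet_preimage (by fun_prop) (h.measurable k hS)

/-! ### Shifting and splicing samples -/

theorem history_congr (alg : Strategy K) {ω ω' : Sample K} {t : ℕ}
    (h : ∀ s, 1 ≤ s → s ≤ t → ω s = ω' s) : history alg ω t = history alg ω' t := by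
  induction t with
  | zero => rfl
  | succ t ih =>
    have h1 := ih fun s h1 h2 => h s h1 (by omega)
    simp only [history, h1, h (t + 1) (by omega) le_rfl]

theorem played_congr (alg : Strategy K) {ω ω' : Sample K} {t : ℕ} (ht : 1 ≤ t)
    (h : ∀ s, 1 ≤ s → s ≤ t → ω s = ω' s) : played alg ω t = played alg ω' t := by
  unfold played
  rw [history_congr alg fun s h1 h2 => h s h1 (by omega), h t ht le_rfl]

/-- The environment seen after round `r`. -/
def Environment.shift (env : Environment K) (r : ℕ) : Environment K where
  law t := env.law (r + t)
  isProbabilityMeasure_law t := env.isProbabilityMeasure_law (r + t)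
  reward_mem_Icc t := env.reward_mem_Icc (r + t)

/-- The part of the sample point after round `r`. -/
def shift (r : ℕ) (ω : Sample K) : Sample K := fun t => ω (r + t)

/-- The sample point that agrees with `ω` up to round `r` and with `ω'` afterwards. -/
def splice (r : ℕ) (ω ω' : Sample K) : Sample K := fun t => if t ≤ r then ω t else ω' t

theorem measurable_shift (r : ℕ) : Measurable (shift (K := K) r) :=
  measurable_pi_lambda _ fun _ => measurable_pi_apply _

theorem measurable_splice (r : ℕ) :
    Measurable fun p : Sample K × Sample K => splice r p.1 p.2 := by
  refine measurable_pi_lambda _ fun t => ?_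
  unfold splice
  split_ifs <;> fun_prop

theorem map_shift_runMeasure (env : Environment K) (r : ℕ) :
    (runMeasure env).map (shift r) = runMeasure (env.shift r) := by
  unfold runMeasure
  refine Measure.eq_infinitePi (fun t => (volume : Measure unitInterval).prod ((env.shift r).law t))
    fun s t ht => ?_
  rw [Measure.map_apply (measurable_shift r)
    (MeasurableSet.pi s.countable_toSet fun i _ => ht i)]
  have : shift r ⁻¹' ((s : Set ℕ).pi t) =
      ((s.map (addLeftEmbedding r) : Finset ℕ) : Set ℕ).pi fun n => t (n - r) := by
    ext ω
    simp [Set.mem_pi, shift]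
  rw [this, Measure.infinitePi_pi _ fun i _ => ht _]
  simp [Environment.shift]

/-- Resampling all rounds after `r` does not change the law. Independence of past and future becomes
Fubini on two copies of the sample space, without conditional expectations. -/
theorem map_splice_runMeasure (env : Environment K) (r : ℕ) :
    ((runMeasure env).prod (runMeasure env)).map (fun p => splice r p.1 p.2) =
      runMeasure env := by
  conv_rhs => unfold runMeasure
  refine Measure.eq_infinitePi (fun t => (volume : Measure unitInterval).prod (env.law t))
    fun s t ht => ?_
  rw [Measure.map_apply (measurable_splice r)
    (MeasurableSet.pi s.countable_toSet fun i _ => ht i)]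
  have : (fun p : Sample K × Sample K => splice r p.1 p.2) ⁻¹' ((s : Set ℕ).pi t) =
      ((s.filter (· ≤ r) : Finset ℕ) : Set ℕ).pi t ×ˢ
        ((s.filter (¬ · ≤ r) : Finset ℕ) : Set ℕ).pi t := by
    ext ⟨ω, ω'⟩
    simp only [Set.mem_preimage, Set.mem_pi, splice, Set.mem_prod, Finset.mem_coe,
      Finset.mem_filter]
    constructor
    · intro h
      exact ⟨fun i hi => by simpa [hi.2] using h i hi.1, fun i hi => by simpa [hi.2] using h i hi.1⟩
    · rintro ⟨h1, h2⟩ i hi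
      split_ifs with hr
      · exact h1 i ⟨hi, hr⟩
      · exact h2 i ⟨hi, hr⟩
  rw [this, Measure.prod_prod]
  unfold runMeasure
  rw [Measure.infinitePi_pi _ fun i _ => ht i, Measure.infinitePi_pi _ fun i _ => ht i,
    Finset.prod_filter_mul_prod_filter_not]

/-- What happens up to round `r` is independent of the run of an algorithm started afterwards. -/
theorem integral_mul_shift (env : Environment K) (r : ℕ) {f g : Sample K → ℝ}
    (hf : Measurable f) (hg : Measurable g)
    (hf' : ∀ ω ω', f (splice r ω ω') = f ω)
    (hg' : ∀ ω ω', g (shift r (splice r ω ω')) = g (shift r ω')) :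
    ∫ ω, f ω * g (shift r ω) ∂(runMeasure env) =
      (∫ ω, f ω ∂(runMeasure env)) * ∫ ω, g ω ∂(runMeasure (env.shift r)) := by
  have hm : Measurable fun ω => f ω * g (shift r ω) := hf.mul (hg.comp (measurable_shift r))
  -- After the future is resampled, `f` sees only the first copy and `g` only the second.
  conv_lhs => rw [← map_splice_runMeasure env r]
  rw [integral_map (measurable_splice r).aemeasurable hm.aestronglyMeasurable]
  simp_rw [hf', hg']
  rw [integral_prod_mul f fun ω => g (shift r ω), ← map_shift_runMeasure,
    integral_map (measurable_shift r).aemeasurable hg.aestronglyMeasurable]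

/-- The reward vector of round `t + 1` and its seed are independent of the past. -/
theorem lintegral_next (env : Environment K) (t : ℕ)
    {F : Sample K → unitInterval → (Fin K → ℝ) → ENNReal}
    (hF : Measurable fun p : Sample K × unitInterval × (Fin K → ℝ) => F p.1 p.2.1 p.2.2)
    (hF' : ∀ ω ω', F (splice t ω ω') = F ω) :
    ∫⁻ ω, F ω (ω (t + 1)).1 (ω (t + 1)).2 ∂(runMeasure env) =
      ∫⁻ ω, ∫⁻ u, ∫⁻ x, F ω u x ∂(env.law (t + 1)) ∂volume ∂(runMeasure env) := by
  have hm : Measurable fun ω : Sample K => F ω (ω (t + 1)).1 (ω (t + 1)).2 :=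
    hF.comp (measurable_id.prodMk (measurable_pi_apply (t + 1)))
  conv_lhs => rw [← map_splice_runMeasure env t]
  rw [lintegral_map hm (measurable_splice t)]
  simp_rw [hF']
  have : ∀ p : Sample K × Sample K, splice t p.1 p.2 (t + 1) = p.2 (t + 1) := fun p => by
    simp [splice]
  simp_rw [this]
  have hm' : Measurable fun p : Sample K × Sample K =>
      F p.1 (p.2 (t + 1)).1 (p.2 (t + 1)).2 :=
    hF.comp (measurable_fst.prodMk ((measurable_pi_apply (t + 1)).comp measurable_snd))
  rw [lintegral_prod _ hm'.aemeasurable]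
  refine lintegral_congr fun ω => ?_
  have hFω : Measurable fun y : unitInterval × (Fin K → ℝ) => F ω y.1 y.2 :=
    hF.comp (measurable_const.prodMk measurable_id)
  have h2 := (measurePreserving_eval_infinitePi
    (fun t => (volume : Measure unitInterval).prod (env.law t)) (t + 1)).lintegral_comp hFω
  rw [lintegral_prod _ hFω.aemeasurable] at h2
  exact h2

/-! ### The ADR-bandit between two resets -/

theorem length_history (alg : Strategy K) (ω : Sample K) (t : ℕ) :
    (history alg ω t).length = t := by
  simp [history_eq_ofFn]

theorem take_history (alg : Strategy K) (ω : Sample K) {m t : ℕ} (h : m ≤ t) :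
    (history alg ω t).take m = history alg ω m := by
  induction t, h using Nat.le_induction with
  | base => rw [List.take_of_length_le (length_history ..).le]
  | succ t h ih => rw [history_succ, List.take_append_of_le_length (by rwa [length_history]), ih]

/-- The window of the ADR-bandit after round `t`. -/
def adrWindow (δ : ℝ) (base : Strategy K) (ω : Sample K) (t : ℕ) : List (Obs K) :=
  window δ (history (adrBandit δ base) ω t)

theorem adrWindow_zero (δ : ℝ) (base : Strategy K) (ω : Sample K) :
    adrWindow δ base ω 0 = [] := rfl

theorem played_adrBandit_succ (δ : ℝ) (base : Strategy K) (ω : Sample K) (t : ℕ) :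
    played (adrBandit δ base) ω (t + 1) = base (adrWindow δ base ω t) (ω (t + 1)).1 := rfl

theorem adrWindow_succ (δ : ℝ) (base : Strategy K) (ω : Sample K) (t : ℕ) :
    adrWindow δ base ω (t + 1) =
      open Classical in
      if Detects δ (adrWindow δ base ω t ++ [obsAt (adrBandit δ base) ω (t + 1)]) then []
      else adrWindow δ base ω t ++ [obsAt (adrBandit δ base) ω (t + 1)] := by
  unfold adrWindow
  rw [history_succ, window_append_singleton]

/-- `InPhase δ base ω r t` says that the ADR-bandit was restarted right after round `r`, and not
again up to round `t`. -/
def InPhase (δ : ℝ) (base : Strategy K) (ω : Sample K) (r t : ℕ) : Prop :=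
  r ≤ t ∧ ∀ s, r ≤ s → s ≤ t → (adrWindow δ base ω s).length = s - r

theorem InPhase.mono {δ : ℝ} {base : Strategy K} {ω : Sample K} {r t s : ℕ}
    (h : InPhase δ base ω r t) (h1 : r ≤ s) (h2 : s ≤ t) : InPhase δ base ω r s :=
  ⟨h1, fun u hu hu' => h.2 u hu (hu'.trans h2)⟩

/-- Pathwise identity, seeds included. It allows the assumptions on a base algorithm run alone to be
used inside a phase. -/
theorem InPhase.adrWindow_eq {δ : ℝ} {base : Strategy K} {ω : Sample K} {r k : ℕ}
    (h : InPhase δ base ω r (r + k)) :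
    adrWindow δ base ω (r + k) = history base (shift r ω) k := by
  induction k with
  | zero =>
    have := h.2 r le_rfl (by omega)
    simpa [history] using this
  | succ k ih =>
    have ih := ih (h.mono (by omega) (by omega))
    have h1 := h.2 (r + (k + 1)) (by omega) le_rfl
    rw [← add_assoc, adrWindow_succ] at h1 ⊢
    split_ifs at h1 ⊢ with hd
    · simp at h1; omega
    · rw [ih, history_succ]
      congr 2
      unfold obsAt
      rw [played_adrBandit_succ, ih]
      rfl

theorem InPhase.played_eq {δ : ℝ} {base : Strategy K} {ω : Sample K} {r k : ℕ}
    (h : InPhase δ base ω r (r + k)) :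
    played (adrBandit δ base) ω (r + k + 1) = played base (shift r ω) (k + 1) := by
  rw [played_adrBandit_succ, h.adrWindow_eq]; rfl

theorem InPhase.adrWindow_append {δ : ℝ} {base : Strategy K} {ω : Sample K} {r k : ℕ}
    (h : InPhase δ base ω r (r + k)) :
    adrWindow δ base ω (r + k) ++ [obsAt (adrBandit δ base) ω (r + k + 1)] =
      history base (shift r ω) (k + 1) := by
  rw [h.adrWindow_eq, history_succ]
  unfold obsAt
  rw [h.played_eq]
  rfl

/-- After each round, the phase continues or a new one begins. -/
theorem InPhase.succ_or {δ : ℝ} {base : Strategy K} {ω : Sample K} {r k : ℕ}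
    (h : InPhase δ base ω r (r + k)) :
    (¬ Detects δ (history base (shift r ω) (k + 1)) ∧ InPhase δ base ω r (r + k + 1)) ∨
    (Detects δ (history base (shift r ω) (k + 1)) ∧
      InPhase δ base ω (r + k + 1) (r + k + 1)) := by
  have h1 := adrWindow_succ δ base ω (r + k)
  rw [h.adrWindow_append] at h1
  split_ifs at h1 with hd
  · refine Or.inr ⟨hd, le_rfl, fun s h2 h3 => ?_⟩
    obtain rfl : s = r + k + 1 := by omega
    simp [h1]
  · refine Or.inl ⟨hd, by omega, fun s h2 h3 => ?_⟩
    rcases Nat.lt_or_ge s (r + k + 1) with h4 | h4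
    · exact h.2 s h2 (by omega)
    · obtain rfl : s = r + k + 1 := by omega
      rw [h1, length_history]; omega

/-! ### Numbers and sums of observations -/

/-- The number of observations of arm `i` in the rounds `1, …, t`. -/
def obsCount (alg : Strategy K) (ω : Sample K) (i : Fin K) (t : ℕ) : ℕ :=
  ∑ k ∈ Finset.range t, if i ∈ played alg ω (k + 1) then 1 else 0

/-- The sum of the observed rewards of arm `i` in the rounds `1, …, t`. -/
def obsSum (alg : Strategy K) (ω : Sample K) (i : Fin K) (t : ℕ) : ℝ :=
  ∑ k ∈ Finset.range t, if i ∈ played alg ω (k + 1) then (ω (k + 1)).2 i else 0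

theorem obsCount_mono (alg : Strategy K) (ω : Sample K) (i : Fin K) :
    Monotone (obsCount alg ω i) := fun _ _ h =>
  Finset.sum_le_sum_of_subset (Finset.range_subset_range.2 h)

theorem obsCount_le (alg : Strategy K) (ω : Sample K) (i : Fin K) (t : ℕ) :
    obsCount alg ω i t ≤ t := by
  calc obsCount alg ω i t ≤ ∑ k ∈ Finset.range t, 1 :=
        Finset.sum_le_sum fun k _ => by split_ifs <;> simp
    _ = t := by simp

theorem count_history (alg : Strategy K) (ω : Sample K) (i : Fin K) (t : ℕ) :
    count i (history alg ω t) = obsCount alg ω i t := by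
  rw [count_eq_sum]
  induction t with
  | zero => simp [history, obsCount]
  | succ t ih =>
    rw [history_succ, List.map_append, List.sum_append, ih, obsCount, obsCount,
      Finset.sum_range_succ]
    simp [obsAt, observe]

theorem sum_history (alg : Strategy K) (ω : Sample K) (i : Fin K) (t : ℕ) :
    ((history alg ω t).map fun o => if i ∈ o.1 then o.2 i else 0).sum = obsSum alg ω i t := by
  induction t with
  | zero => simp [history, obsSum]
  | succ t ih =>
    rw [history_succ, List.map_append, List.sum_append, ih, obsSum, obsSum,
      Finset.sum_range_succ]
    simp only [obsAt, observe, List.map_cons, List.map_nil, List.sum_cons, List.sum_nil, add_zero]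
    split_ifs <;> rfl

theorem count_drop_history (alg : Strategy K) (ω : Sample K) (i : Fin K) {m t : ℕ} (h : m ≤ t) :
    obsCount alg ω i m + count i ((history alg ω t).drop m) = obsCount alg ω i t := by
  rw [← count_history, ← count_history, ← take_history alg ω h, count_eq_sum, count_eq_sum,
    count_eq_sum, ← List.sum_append, ← List.map_append, List.take_append_drop]

theorem sum_drop_history (alg : Strategy K) (ω : Sample K) (i : Fin K) {m t : ℕ} (h : m ≤ t) :
    (((history alg ω t).drop m).map fun o => if i ∈ o.1 then o.2 i else 0).sum =
      obsSum alg ω i t - obsSum alg ω i m := by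
  rw [eq_sub_iff_add_eq', ← sum_history, ← sum_history, ← take_history alg ω h,
    ← List.sum_append, ← List.map_append, List.take_append_drop]

theorem InPhase.obsCount_eq {δ : ℝ} {base : Strategy K} {ω : Sample K} {r k : ℕ}
    (h : InPhase δ base ω r (r + k)) (i : Fin K) {m : ℕ} (hm : m ≤ k + 1) :
    obsCount (adrBandit δ base) ω i (r + m) =
      obsCount (adrBandit δ base) ω i r + obsCount base (shift r ω) i m := by
  simp only [obsCount]
  rw [Finset.sum_range_add]
  congr 1
  refine Finset.sum_congr rfl fun j hj => ?_
  rw [(h.mono (s := r + j) (by omega) (by simp at hj; omega)).played_eq]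

theorem InPhase.obsSum_eq {δ : ℝ} {base : Strategy K} {ω : Sample K} {r k : ℕ}
    (h : InPhase δ base ω r (r + k)) (i : Fin K) {m : ℕ} (hm : m ≤ k + 1) :
    obsSum (adrBandit δ base) ω i (r + m) =
      obsSum (adrBandit δ base) ω i r + obsSum base (shift r ω) i m := by
  simp only [obsSum]
  rw [Finset.sum_range_add]
  congr 1
  refine Finset.sum_congr rfl fun j hj => ?_
  rw [(h.mono (s := r + j) (by omega) (by simp at hj; omega)).played_eq]
  rfl

/-- Detection in terms of the observations of the ADR-bandit. -/
theorem InPhase.detects_iff {δ : ℝ} {base : Strategy K} {ω : Sample K} {r k : ℕ}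
    (h : InPhase δ base ω r (r + k)) {N : Fin K → ℕ → ℕ} {R : Fin K → ℕ → ℝ}
    (hN : N = obsCount (adrBandit δ base) ω) (hR : R = obsSum (adrBandit δ base) ω) :
    Detects δ (history base (shift r ω) (k + 1)) ↔ ∃ i m, m ≤ k + 1 ∧ N i r < N i (r + m) ∧
      N i (r + m) < N i (r + k + 1) ∧
      cutThreshold δ (N i (r + m) - N i r) (N i (r + k + 1) - N i (r + m)) ≤
        |(R i (r + m) - R i r) / (N i (r + m) - N i r : ℕ) -
          (R i (r + k + 1) - R i (r + m)) / (N i (r + k + 1) - N i (r + m) : ℕ)| := by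
  subst hN hR
  have key : ∀ i m, m ≤ k + 1 →
      (obsCount (adrBandit δ base) ω i (r + m) - obsCount (adrBandit δ base) ω i r =
        count i ((history base (shift r ω) (k + 1)).take m)) ∧
      (obsCount (adrBandit δ base) ω i (r + k + 1) - obsCount (adrBandit δ base) ω i (r + m) =
        count i ((history base (shift r ω) (k + 1)).drop m)) ∧
      (obsSum (adrBandit δ base) ω i (r + m) - obsSum (adrBandit δ base) ω i r) =
        (((history base (shift r ω) (k + 1)).take m).map
          fun o => if i ∈ o.1 then o.2 i else 0).sum ∧
      (obsSum (adrBandit δ base) ω i (r + k + 1) - obsSum (adrBandit δ base) ω i (r + m)) =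
        (((history base (shift r ω) (k + 1)).drop m).map
          fun o => if i ∈ o.1 then o.2 i else 0).sum := by
    intro i m hm
    have h1 := h.obsCount_eq i hm
    have h2 := h.obsCount_eq i (m := k + 1) le_rfl
    have h3 := h.obsSum_eq i hm
    have h4 := h.obsSum_eq i (m := k + 1) le_rfl
    have h5 := count_drop_history base (shift r ω) i hm
    rw [← add_assoc] at h2 h4
    refine ⟨?_, ?_, ?_, ?_⟩
    · rw [take_history _ _ hm, count_history, h1]; omega
    · omega
    · rw [take_history _ _ hm, sum_history, h3]; ring
    · rw [sum_drop_history _ _ _ hm, h3, h4]; ring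
  constructor
  · rintro ⟨i, m, h1, h2, h3⟩
    have hm : m ≤ k + 1 := by
      by_contra hm
      rw [List.drop_eq_nil_of_le (by rw [length_history]; omega)] at h2
      simp [count] at h2
    obtain ⟨k1, k2, k3, k4⟩ := key i m hm
    refine ⟨i, m, hm, by omega, by omega, ?_⟩
    rw [k1, k2, k3, k4, ← empMean_eq_sum, ← empMean_eq_sum]
    exact h3
  · rintro ⟨i, m, hm, h1, h2, h3⟩
    obtain ⟨k1, k2, k3, k4⟩ := key i m hm
    refine ⟨i, m, by omega, by omega, ?_⟩
    rw [k1, k2, k3, k4, ← empMean_eq_sum, ← empMean_eq_sum] at h3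
    exact h3

/-! ### Concentration of the empirical means -/

theorem obsCount_succ (alg : Strategy K) (ω : Sample K) (i : Fin K) (t : ℕ) :
    obsCount alg ω i (t + 1) =
      obsCount alg ω i t + if i ∈ played alg ω (t + 1) then 1 else 0 :=
  Finset.sum_range_succ _ _

theorem measurable_history_map {L : ℕ} {alg : Strategy K} (h : IsBanditAlgorithm L alg) (t : ℕ) :
    Measurable fun p : Sample K × unitInterval => alg (history alg p.1 t) p.2 := by
  simp_rw [history_eq_ofFn]
  exact (h.measurable t).comp (Measurable.prodMk (measurable_pi_lambda _ fun k =>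
    (measurable_obsAt h _).comp measurable_fst) measurable_snd)

theorem measurableSet_mem_played {L : ℕ} {alg : Strategy K} (h : IsBanditAlgorithm L alg)
    (i : Fin K) (t : ℕ) : MeasurableSet {ω | i ∈ played alg ω t} :=
  measurable_played h t (MeasurableSet.of_discrete (s := {I : Finset (Fin K) | i ∈ I}))

theorem measurable_obsCount {L : ℕ} {alg : Strategy K} (h : IsBanditAlgorithm L alg)
    (i : Fin K) (t : ℕ) : Measurable fun ω => obsCount alg ω i t :=
  Finset.measurable_fun_sum _ fun _ _ =>
    Measurable.ite (measurableSet_mem_played h i _) measurable_const measurable_const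

/-- Arm `i` is played in round `k + 1`, and this is one of its observations number
`a + 1, …, b`. -/
def Selected (alg : Strategy K) (i : Fin K) (a b : ℕ) (ω : Sample K) (k : ℕ) : Prop :=
  i ∈ played alg ω (k + 1) ∧ a ≤ obsCount alg ω i k ∧ obsCount alg ω i k < b

open Classical in
/-- The deviation of the observations number `a + 1, …, b` of arm `i` from their means. -/
def selDev (env : Environment K) (alg : Strategy K) (i : Fin K) (a b : ℕ) (ω : Sample K)
    (t : ℕ) : ℝ :=
  ∑ k ∈ Finset.range t, if Selected alg i a b ω k then (ω (k + 1)).2 i - env.mean i (k + 1) else 0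

open Classical in
/-- The number of observations among the observations number `a + 1, …, b` of arm `i`. -/
def selCount (alg : Strategy K) (i : Fin K) (a b : ℕ) (ω : Sample K) (t : ℕ) : ℕ :=
  ∑ k ∈ Finset.range t, if Selected alg i a b ω k then 1 else 0

/-- Once arm `i` has been observed `b` times, the count is the deterministic number `b - a`. This is
why deviations are indexed by observation numbers and not by rounds. -/
theorem selCount_eq (alg : Strategy K) (i : Fin K) {a b : ℕ} (hab : a ≤ b) (ω : Sample K)
    (t : ℕ) :
    selCount alg i a b ω t + min (obsCount alg ω i t) a = min (obsCount alg ω i t) b := by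
  induction t with
  | zero => simp [selCount, obsCount]
  | succ t ih =>
    have : selCount alg i a b ω (t + 1) = selCount alg i a b ω t +
        open Classical in if Selected alg i a b ω t then 1 else 0 := Finset.sum_range_succ _ _
    rw [this, obsCount_succ]
    unfold Selected
    split_ifs <;> grind

theorem measurableSet_selected {L : ℕ} {alg : Strategy K} (h : IsBanditAlgorithm L alg)
    (i : Fin K) (a b k : ℕ) : MeasurableSet {ω | Selected alg i a b ω k} := by
  have h1 := measurable_obsCount h i k (MeasurableSet.of_discrete (s := Set.Ico a b))
  exact (measurableSet_mem_played h i (k + 1)).inter h1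

theorem measurable_selDev (env : Environment K) {L : ℕ} {alg : Strategy K}
    (h : IsBanditAlgorithm L alg) (i : Fin K) (a b t : ℕ) :
    Measurable fun ω => selDev env alg i a b ω t :=
  Finset.measurable_fun_sum _ fun k _ =>
    Measurable.ite (measurableSet_selected h i a b k) (by fun_prop) measurable_const

theorem measurable_selCount {L : ℕ} {alg : Strategy K}
    (h : IsBanditAlgorithm L alg) (i : Fin K) (a b t : ℕ) :
    Measurable fun ω => selCount alg i a b ω t :=
  Finset.measurable_fun_sum _ fun k _ =>
    Measurable.ite (measurableSet_selected h i a b k) (by fun_prop) measurable_const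

/-- Hoeffding's lemma for a variable with values in `[0,1]`, which is sub-Gaussian with variance
proxy `1/4`. -/
theorem lintegral_exp_reward_le (env : Environment K) (i : Fin K) (t : ℕ) (l : ℝ) :
    ∫⁻ x, ENNReal.ofReal (Real.exp (l * (x i - env.mean i t) - l ^ 2 / 8)) ∂(env.law t) ≤ 1 := by
  have hb : ∀ᵐ x ∂(env.law t), x i ∈ Set.Icc (0 : ℝ) 1 :=
    (env.reward_mem_Icc t).mono fun x hx => hx i
  have hs := ProbabilityTheory.hasSubgaussianMGF_of_mem_Icc (μ := env.law t)
    (X := fun x => x i) (measurable_pi_apply i).aemeasurable hb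
  have h1 := hs.mgf_le l
  have h2 := hs.integrable_exp_mul l
  have h3 : ∀ x : Fin K → ℝ, ENNReal.ofReal (Real.exp (l * (x i - env.mean i t) - l ^ 2 / 8)) =
      ENNReal.ofReal (Real.exp (l * (x i - env.mean i t))) *
        ENNReal.ofReal (Real.exp (-(l ^ 2 / 8))) := fun x => by
    rw [← ENNReal.ofReal_mul (Real.exp_nonneg _), ← Real.exp_add]; ring_nf
  simp_rw [h3]
  rw [lintegral_mul_const _ (by fun_prop)]
  unfold Environment.mean
  rw [← ofReal_integral_eq_lintegral_ofReal h2 (Filter.Eventually.of_forall fun _ =>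
    Real.exp_nonneg _), ← ENNReal.ofReal_mul (integral_nonneg fun _ => Real.exp_nonneg _)]
  refine ENNReal.ofReal_le_one.2 ?_
  calc _ ≤ Real.exp (l ^ 2 / 8) * Real.exp (-(l ^ 2 / 8)) := by
        refine mul_le_mul_of_nonneg_right (h1.trans_eq ?_) (Real.exp_nonneg _)
        congr 1
        norm_num
        ring
    _ = 1 := by rw [← Real.exp_add]; simp

theorem selected_congr (alg : Strategy K) (i : Fin K) (a b : ℕ) {ω ω' : Sample K} {k : ℕ}
    (h : ∀ s, 1 ≤ s → s ≤ k + 1 → ω s = ω' s) :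
    Selected alg i a b ω k = Selected alg i a b ω' k := by
  have : obsCount alg ω i k = obsCount alg ω' i k := by
    rw [← count_history, ← count_history, history_congr alg fun s h1 h2 => h s h1 (by omega)]
  unfold Selected
  rw [this, played_congr alg (by omega) h]

/-- The integrand is an exponential supermartingale: whether a round is selected is settled by the
past and the seed, before its reward is drawn, so Hoeffding's lemma applies to each selected reward.
-/
theorem lintegral_exp_selDev_le (env : Environment K) {L : ℕ} {alg : Strategy K}
    (h : IsBanditAlgorithm L alg) (i : Fin K) (a b t : ℕ) (l : ℝ) :
    ∫⁻ ω, ENNReal.ofReal (Real.exp (l * selDev env alg i a b ω t -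
      l ^ 2 / 8 * selCount alg i a b ω t)) ∂(runMeasure env) ≤ 1 := by
  classical
  induction t with
  | zero => simp [selDev, selCount]
  | succ t ih =>
    set Z : Sample K → ENNReal := fun ω => ENNReal.ofReal (Real.exp (l * selDev env alg i a b ω t -
      l ^ 2 / 8 * selCount alg i a b ω t)) with hZ
    have hZm : Measurable Z := by
      have h1 := measurable_selDev env h i a b t
      have h2 : Measurable fun ω => (selCount alg i a b ω t : ℝ) :=
        Measurable.of_discrete.comp (measurable_selCount h i a b t)
      fun_prop
    -- `Selected` with the seed of round `t + 1` left free, so that seed and reward can be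
    -- integrated out.
    let P : Sample K → unitInterval → Prop := fun ω u =>
      i ∈ alg (history alg ω t) u ∧ a ≤ obsCount alg ω i t ∧ obsCount alg ω i t < b
    let F : Sample K → unitInterval → (Fin K → ℝ) → ENNReal := fun ω u x =>
      Z ω * if P ω u then
        ENNReal.ofReal (Real.exp (l * (x i - env.mean i (t + 1)) - l ^ 2 / 8)) else 1
    have hP : MeasurableSet {p : Sample K × unitInterval × (Fin K → ℝ) | P p.1 p.2.1} := by
      have h1 := measurable_history_map h t
        (MeasurableSet.of_discrete (s := {I : Finset (Fin K) | i ∈ I}))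
      have h2 := measurable_obsCount h i t (MeasurableSet.of_discrete (s := Set.Ico a b))
      have hq : Measurable fun p : Sample K × unitInterval × (Fin K → ℝ) => (p.1, p.2.1) := by
        fun_prop
      exact (hq h1).inter (measurable_fst h2)
    have hF : Measurable fun p : Sample K × unitInterval × (Fin K → ℝ) => F p.1 p.2.1 p.2.2 :=
      (hZm.comp measurable_fst).mul (Measurable.ite hP (by fun_prop) measurable_const)
    have hF' : ∀ ω ω', F (splice t ω ω') = F ω := by
      intro ω ω'
      have hs : ∀ s, 1 ≤ s → s ≤ t → splice t ω ω' s = ω s := fun s _ h2 => by simp [splice, h2]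
      have e1 : history alg (splice t ω ω') t = history alg ω t := history_congr alg hs
      have e2 : selDev env alg i a b (splice t ω ω') t = selDev env alg i a b ω t := by
        refine Finset.sum_congr rfl fun k hk => ?_
        have hk : k + 1 ≤ t := by simpa using hk
        rw [selected_congr alg i a b fun s h1 h2 => hs s h1 (h2.trans hk),
          hs (k + 1) (by omega) hk]
      have e3 : selCount alg i a b (splice t ω ω') t = selCount alg i a b ω t := by
        refine Finset.sum_congr rfl fun k hk => ?_
        have hk : k + 1 ≤ t := by simpa using hk
        rw [selected_congr alg i a b fun s h1 h2 => hs s h1 (h2.trans hk)]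
      simp only [F, P, Z, ← count_history, e1, e2, e3]
    have hstep : ∀ ω, ENNReal.ofReal (Real.exp (l * selDev env alg i a b ω (t + 1) -
        l ^ 2 / 8 * selCount alg i a b ω (t + 1))) = F ω (ω (t + 1)).1 (ω (t + 1)).2 := by
      intro ω
      have e1 : selDev env alg i a b ω (t + 1) = selDev env alg i a b ω t +
        if Selected alg i a b ω t then (ω (t + 1)).2 i - env.mean i (t + 1) else 0 :=
          Finset.sum_range_succ _ _
      have e2 : selCount alg i a b ω (t + 1) = selCount alg i a b ω t +
        if Selected alg i a b ω t then 1 else 0 := Finset.sum_range_succ _ _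
      have e3 : P ω (ω (t + 1)).1 ↔ Selected alg i a b ω t := Iff.rfl
      simp only [F, e3]
      rw [e1, e2, hZ]
      split_ifs
      · rw [← ENNReal.ofReal_mul (Real.exp_nonneg _), ← Real.exp_add]
        push_cast
        ring_nf
      · simp
    simp_rw [hstep]
    rw [lintegral_next env t hF hF']
    refine le_trans (lintegral_mono fun ω => ?_) ih
    calc ∫⁻ u, ∫⁻ x, F ω u x ∂(env.law (t + 1)) ∂volume ≤ ∫⁻ _u : unitInterval, Z ω ∂volume := by
          refine lintegral_mono fun u => ?_
          simp only [F]
          split_ifs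
          · rw [lintegral_const_mul _ (by fun_prop)]
            exact mul_le_of_le_one_right' (lintegral_exp_reward_le env i (t + 1) l)
          · simp
      _ = Z ω := by simp

theorem measure_selDev_ge_le (env : Environment K) {L : ℕ} {alg : Strategy K}
    (h : IsBanditAlgorithm L alg) (i : Fin K) {a b : ℕ} (hab : a < b) (t : ℕ) {y : ℝ} (hy : 0 ≤ y)
    {σ : ℝ} (hσ : σ ^ 2 = 1) :
    runMeasure env {ω | b ≤ obsCount alg ω i t ∧
      Real.sqrt ((b - a) * y / 2) ≤ σ * selDev env alg i a b ω t} ≤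
        ENNReal.ofReal (Real.exp (-y)) := by
  have hn : (0 : ℝ) < b - a := by rw [sub_pos]; exact_mod_cast hab
  set s := Real.sqrt ((b - a) * y / 2) with hs
  have hs0 : 0 ≤ s := Real.sqrt_nonneg _
  have hs2 : s ^ 2 = (b - a) * y / 2 := Real.sq_sqrt (by positivity)
  -- The sign `σ` chooses the tail; `4s/(b-a)` is the Chernoff optimum. The linear term is then at
  -- least `2y` and the quadratic correction equals `y`.
  set l : ℝ := σ * (4 * s / (b - a)) with hl
  have h1 := lintegral_exp_selDev_le env h i a b t l
  have hm : Measurable fun ω => ENNReal.ofReal (Real.exp (l * selDev env alg i a b ω t -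
      l ^ 2 / 8 * selCount alg i a b ω t)) := by
    have h1 := measurable_selDev env h i a b t
    have h2 : Measurable fun ω => (selCount alg i a b ω t : ℝ) :=
      Measurable.of_discrete.comp (measurable_selCount h i a b t)
    fun_prop
  have h2 := mul_meas_ge_le_lintegral hm (μ := runMeasure env) (ENNReal.ofReal (Real.exp y))
  have h3 : runMeasure env {ω | b ≤ obsCount alg ω i t ∧ s ≤ σ * selDev env alg i a b ω t} ≤
      runMeasure env {ω | ENNReal.ofReal (Real.exp y) ≤
        ENNReal.ofReal (Real.exp (l * selDev env alg i a b ω t -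
          l ^ 2 / 8 * selCount alg i a b ω t))} := by
    refine measure_mono fun ω hω => ?_
    obtain ⟨hω1, hω2⟩ := hω
    have hc := selCount_eq alg i hab.le ω t
    rw [min_eq_right hω1, min_eq_right (hab.le.trans hω1)] at hc
    have hc' : (selCount alg i a b ω t : ℝ) = b - a := by
      rw [eq_sub_iff_add_eq]; exact_mod_cast hc
    refine ENNReal.ofReal_le_ofReal (Real.exp_le_exp.2 ?_)
    rw [hc']
    have e1 : l ^ 2 / 8 * (b - a) = y := by
      rw [hl, mul_pow, hσ, div_pow, mul_pow, hs2]; field_simp; ring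
    have e2 : 2 * y ≤ l * selDev env alg i a b ω t := by
      have : 4 * s / (b - a) * s ≤ 4 * s / (b - a) * (σ * selDev env alg i a b ω t) := by
        gcongr
      have e3 : 4 * s / (b - a) * s = 2 * y := by
        have : 4 * s / (b - a) * s = 4 * s ^ 2 / (b - a) := by ring
        rw [this, hs2]; field_simp; ring
      rw [hl]; linarith
    linarith
  have hpos : ENNReal.ofReal (Real.exp y) ≠ 0 := by
    simpa using Real.exp_pos y
  calc _ ≤ _ := h3
    _ ≤ 1 / ENNReal.ofReal (Real.exp y) := by
      rw [ENNReal.le_div_iff_mul_le (Or.inl hpos) (Or.inl ENNReal.ofReal_ne_top), mul_comm]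
      exact h2.trans h1
    _ = _ := by rw [one_div, ← ENNReal.ofReal_inv_of_pos (Real.exp_pos _), Real.exp_neg]

/-- All empirical means of the observations in consecutive rounds up to `T` are close to the
corresponding averages of the means. -/
def Concentrated (env : Environment K) (alg : Strategy K) (T : ℕ) (y : ℝ) (ω : Sample K) : Prop :=
  ∀ i s t, s ≤ t → t ≤ T → obsCount alg ω i s < obsCount alg ω i t →
    |∑ k ∈ Finset.Ico s t, if i ∈ played alg ω (k + 1) then
      (ω (k + 1)).2 i - env.mean i (k + 1) else 0| <
      Real.sqrt ((obsCount alg ω i t - obsCount alg ω i s) * y / 2)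

/-- A stretch of rounds has random endpoints in terms of observation numbers, but only about `T²`
pairs of such numbers occur. This passage makes the union bound over pairs `(a, b)` cover all
stretches. -/
theorem selDev_eq_sum_Ico (env : Environment K) (alg : Strategy K) (i : Fin K) {s t T : ℕ}
    (htT : t ≤ T) (ω : Sample K) :
    selDev env alg i (obsCount alg ω i s) (obsCount alg ω i t) ω T =
      ∑ k ∈ Finset.Ico s t, if i ∈ played alg ω (k + 1) then
        (ω (k + 1)).2 i - env.mean i (k + 1) else 0 := by
  classical
  symm
  unfold selDev
  have hmono := obsCount_mono alg ω i
  have hsub : Finset.Ico s t ⊆ Finset.range T := fun k hk => by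
    simp only [Finset.mem_Ico, Finset.mem_range] at *; omega
  have hiff : ∀ k, Selected alg i (obsCount alg ω i s) (obsCount alg ω i t) ω k →
      k ∈ Finset.Ico s t := by
    rintro k ⟨h1, h2, h3⟩
    rw [Finset.mem_Ico]
    constructor
    · by_contra! hk
      have := hmono (show k + 1 ≤ s from hk)
      rw [obsCount_succ, if_pos h1] at this
      omega
    · by_contra! hk
      have := hmono hk
      omega
  rw [← Finset.sum_subset hsub (fun k _ hk => if_neg fun hsel => hk (hiff k hsel))]
  refine Finset.sum_congr rfl fun k hk => ?_
  obtain ⟨hk1, hk2⟩ := Finset.mem_Ico.1 hk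
  by_cases hp : i ∈ played alg ω (k + 1)
  · rw [if_pos hp, if_pos]
    refine ⟨hp, hmono hk1, ?_⟩
    have := hmono (show k + 1 ≤ t from hk2)
    rw [obsCount_succ, if_pos hp] at this
    omega
  · rw [if_neg hp, if_neg fun hsel => hp hsel.1]

/-- Concentration holds outside of an event of small probability. -/
theorem exists_concentrated (env : Environment K) {L : ℕ} {alg : Strategy K}
    (h : IsBanditAlgorithm L alg) (T : ℕ) {y : ℝ} (hy : 0 ≤ y) :
    ∃ B : Set (Sample K), MeasurableSet B ∧
      (runMeasure env).real B ≤ 2 * K * T ^ 2 * Real.exp (-y) ∧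
      ∀ ω ∉ B, Concentrated env alg T y ω := by
  -- Here `a = p.2.1` and `b = p.2.2 + 1`, so that `b` runs through `1, …, T`.
  let E : Fin K × Fin T × Fin T → Set (Sample K) := fun p =>
    {ω | (p.2.1 : ℕ) < p.2.2 + 1 ∧ (p.2.2 + 1 : ℕ) ≤ obsCount alg ω p.1 T ∧
      Real.sqrt (((p.2.2 + 1 : ℕ) - (p.2.1 : ℕ)) * y / 2) ≤
        |selDev env alg p.1 p.2.1 (p.2.2 + 1) ω T|}
  refine ⟨⋃ p, E p, MeasurableSet.iUnion fun p => ?_, ?_, fun ω hω i s t hst htT hlt => ?_⟩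
  · have h1 : MeasurableSet {ω : Sample K | (p.2.2 + 1 : ℕ) ≤ obsCount alg ω p.1 T} :=
      measurable_obsCount h p.1 T (MeasurableSet.of_discrete (s := Set.Ici _))
    have h2 := measurableSet_le measurable_const (measurable_selDev env h p.1 p.2.1 (p.2.2 + 1) T).abs
      (α := ℝ) (f := fun _ => Real.sqrt (((p.2.2 + 1 : ℕ) - (p.2.1 : ℕ)) * y / 2))
    exact (MeasurableSet.const _).inter (h1.inter h2)
  · have hE : ∀ p, (runMeasure env).real (E p) ≤ 2 * Real.exp (-y) := by
      intro p
      by_cases hp : (p.2.1 : ℕ) < p.2.2 + 1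
      · have key : ∀ σ : ℝ, σ ^ 2 = 1 → (runMeasure env).real
            {ω | (p.2.2 + 1 : ℕ) ≤ obsCount alg ω p.1 T ∧
              Real.sqrt (((p.2.2 + 1 : ℕ) - (p.2.1 : ℕ)) * y / 2) ≤
              σ * selDev env alg p.1 p.2.1 (p.2.2 + 1) ω T} ≤ Real.exp (-y) := by
          intro σ hσ
          have := ENNReal.toReal_mono ENNReal.ofReal_ne_top
            (measure_selDev_ge_le env h p.1 hp T hy hσ)
          rwa [ENNReal.toReal_ofReal (Real.exp_nonneg _)] at this
        have hsub : E p ⊆ {ω | (p.2.2 + 1 : ℕ) ≤ obsCount alg ω p.1 T ∧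
              Real.sqrt (((p.2.2 + 1 : ℕ) - (p.2.1 : ℕ)) * y / 2) ≤
              1 * selDev env alg p.1 p.2.1 (p.2.2 + 1) ω T} ∪
            {ω | (p.2.2 + 1 : ℕ) ≤ obsCount alg ω p.1 T ∧
              Real.sqrt (((p.2.2 + 1 : ℕ) - (p.2.1 : ℕ)) * y / 2) ≤
              (-1) * selDev env alg p.1 p.2.1 (p.2.2 + 1) ω T} := by
          rintro ω ⟨-, h1, h2⟩
          rcases le_abs.1 h2 with h3 | h3
          · exact Or.inl ⟨h1, by linarith⟩
          · exact Or.inr ⟨h1, by linarith⟩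
        calc _ ≤ _ := measureReal_mono hsub
          _ ≤ _ := measureReal_union_le _ _
          _ ≤ _ := by linarith [key 1 (by norm_num), key (-1) (by norm_num)]
      · have : E p = ∅ := Set.eq_empty_of_forall_notMem fun ω hω => hp hω.1
        rw [this]; simp; positivity
    calc _ ≤ ∑ p, (runMeasure env).real (E p) := measureReal_iUnion_fintype_le _
      _ ≤ ∑ _p : Fin K × Fin T × Fin T, 2 * Real.exp (-y) := Finset.sum_le_sum fun p _ => hE p
      _ = _ := by simp; ring
  · by_contra hcon
    rw [not_lt] at hcon
    refine hω (Set.mem_iUnion.2 ?_)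
    have hs : obsCount alg ω i s < T := by
      have := obsCount_le alg ω i t; omega
    have ht : obsCount alg ω i t - 1 < T := by
      have := obsCount_le alg ω i t; omega
    have e : obsCount alg ω i t - 1 + 1 = obsCount alg ω i t := by omega
    refine ⟨(i, ⟨_, hs⟩, ⟨_, ht⟩), ?_⟩
    simp only [E, Set.mem_ofPred_eq, e]
    refine ⟨hlt, obsCount_mono alg ω i htT, ?_⟩
    rw [selDev_eq_sum_Ico env alg i htT]
    exact hcon

/-! ### Detections when all empirical means are concentrated -/

theorem obsSum_sub (alg : Strategy K) (ω : Sample K) (i : Fin K) {s t : ℕ} (h : s ≤ t) :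
    obsSum alg ω i t - obsSum alg ω i s =
      ∑ k ∈ Finset.Ico s t, if i ∈ played alg ω (k + 1) then (ω (k + 1)).2 i else 0 :=
  (Finset.sum_Ico_eq_sub _ h).symm

theorem obsCount_sub (alg : Strategy K) (ω : Sample K) (i : Fin K) {s t : ℕ} (h : s ≤ t) :
    (obsCount alg ω i t : ℝ) - obsCount alg ω i s =
      ∑ k ∈ Finset.Ico s t, if i ∈ played alg ω (k + 1) then 1 else 0 := by
  rw [Finset.sum_Ico_eq_sub _ h]; simp [obsCount]

/-- Under concentration, the empirical mean over a stationary stretch is close to the mean. -/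
theorem Concentrated.abs_sub_lt {env : Environment K} {alg : Strategy K} {T : ℕ} {y : ℝ}
    {ω : Sample K} (h : Concentrated env alg T y ω) {i : Fin K} {s t : ℕ} (hst : s ≤ t)
    (htT : t ≤ T) (hlt : obsCount alg ω i s < obsCount alg ω i t) {μ : ℝ}
    (hμ : ∀ u, s < u → u ≤ t → env.mean i u = μ) :
    |(obsSum alg ω i t - obsSum alg ω i s) / (obsCount alg ω i t - obsCount alg ω i s : ℕ) - μ| <
      Real.sqrt (1 / (2 * (obsCount alg ω i t - obsCount alg ω i s : ℕ)) * y) := by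
  have h1 := h i s t hst htT hlt
  rw [Nat.cast_sub hlt.le]
  set n : ℝ := (obsCount alg ω i t : ℝ) - obsCount alg ω i s with hn
  have hn0 : 0 < n := by rw [hn, sub_pos]; exact_mod_cast hlt
  have h2 : (∑ k ∈ Finset.Ico s t, if i ∈ played alg ω (k + 1) then
      (ω (k + 1)).2 i - env.mean i (k + 1) else 0) =
      obsSum alg ω i t - obsSum alg ω i s - n * μ := by
    rw [obsSum_sub _ _ _ hst, hn, obsCount_sub _ _ _ hst, Finset.sum_mul, ← Finset.sum_sub_distrib]
    refine Finset.sum_congr rfl fun k hk => ?_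
    obtain ⟨hk1, hk2⟩ := Finset.mem_Ico.1 hk
    split_ifs
    · rw [hμ (k + 1) (by omega) (by omega), one_mul]
    · ring
  rw [h2] at h1
  have h3 : (obsSum alg ω i t - obsSum alg ω i s) / n - μ =
      (obsSum alg ω i t - obsSum alg ω i s - n * μ) / n := by field_simp
  have h4 : Real.sqrt (1 / (2 * n) * y) = Real.sqrt (n * y / 2) / n := by
    rw [show 1 / (2 * n) * y = (n * y / 2) / n ^ 2 by field_simp, Real.sqrt_div' _ (by positivity),
      Real.sqrt_sq hn0.le]
  rw [h3, h4, abs_div, abs_of_pos hn0]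
  exact div_lt_div_of_pos_right h1 hn0

/-- There are no false alarms under concentration. -/
theorem Concentrated.not_detects {env : Environment K} {base : Strategy K} {δ : ℝ} {T : ℕ} {y : ℝ}
    {ω : Sample K} (h : Concentrated env (adrBandit δ base) T y ω) (hy : y ≤ Real.log (1 / δ))
    {r k : ℕ} (hp : InPhase δ base ω r (r + k)) (hT : r + k + 1 ≤ T)
    (hconst : ∀ i u v, r < u → u ≤ r + k + 1 → r < v → v ≤ r + k + 1 →
      env.mean i u = env.mean i v) :
    ¬ Detects δ (history base (shift r ω) (k + 1)) := by
  rw [hp.detects_iff rfl rfl]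
  rintro ⟨i, m, hm, h1, h2, h3⟩
  have a1 := h.abs_sub_lt (i := i) (s := r) (t := r + m) (by omega) (by omega) h1
    (μ := env.mean i (r + 1)) fun u hu hu' =>
      hconst i u (r + 1) hu (by omega) (by omega) (by omega)
  have a2 := h.abs_sub_lt (i := i) (s := r + m) (t := r + k + 1) (by omega) (by omega) h2
    (μ := env.mean i (r + 1)) fun u hu hu' =>
      hconst i u (r + 1) (by omega) (by omega) (by omega) (by omega)
  refine absurd h3 (not_le.2 ?_)
  unfold cutThreshold
  refine (abs_sub_le _ (env.mean i (r + 1)) _).trans_lt ?_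
  rw [abs_sub_comm (env.mean i (r + 1))]
  refine add_lt_add (a1.trans_le ?_) (a2.trans_le ?_) <;> gcongr

/-- Half the threshold plus one deviation is at most `e / 2`. Concentration at level `l - 1` instead
of `l` pays for the two observations missing in `n + 2`: the square of the sum is at most `(2l -
1)/n`, while `n e² ≥ 8l - 2`. -/
theorem sqrt_add_sqrt_le {l e n : ℝ} (hl : 2 ≤ l) (he : 0 < e) (he1 : e ≤ 1)
    (hn : 16 * (l / (2 * e ^ 2)) ≤ n + 2) :
    0 < n ∧ Real.sqrt (1 / (2 * n) * l) + Real.sqrt (1 / (2 * n) * (l - 1)) ≤ e / 2 := by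
  have he2 : 0 < e ^ 2 := by positivity
  have he3 : e ^ 2 ≤ 1 := pow_le_one₀ he.le he1
  have h1 : 8 * l ≤ (n + 2) * e ^ 2 := by
    have := mul_le_mul_of_nonneg_right hn he2.le
    have e1 : 16 * (l / (2 * e ^ 2)) * e ^ 2 = 8 * l := by field_simp; ring
    linarith
  have hn0 : 0 < n := by
    by_contra! hneg
    nlinarith
  refine ⟨hn0, ?_⟩
  set a := Real.sqrt (1 / (2 * n) * l)
  set b := Real.sqrt (1 / (2 * n) * (l - 1))
  have ha : a ^ 2 = 1 / (2 * n) * l := Real.sq_sqrt (by positivity)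
  have hb : b ^ 2 = 1 / (2 * n) * (l - 1) :=
    Real.sq_sqrt (mul_nonneg (by positivity) (by linarith))
  refine abs_le_of_sq_le_sq' ?_ (by positivity) |>.2
  have h2 : (a + b) ^ 2 ≤ 2 * (a ^ 2 + b ^ 2) := by nlinarith [sq_nonneg (a - b)]
  have h3 : 2 * (a ^ 2 + b ^ 2) = (2 * l - 1) / n := by rw [ha, hb]; field_simp; ring
  rw [h3] at h2
  refine h2.trans ?_
  rw [div_le_iff₀ hn0]
  nlinarith

/-- A sufficiently large change is detected once there are enough observations. -/
theorem Concentrated.detects {env : Environment K} {base : Strategy K} {δ : ℝ} {T : ℕ} {l : ℝ}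
    {ω : Sample K} (h : Concentrated env (adrBandit δ base) T (l - 1) ω)
    (hl : Real.log (1 / δ) = l) (hl2 : 2 ≤ l)
    {r k m : ℕ} (hp : InPhase δ base ω r (r + k)) (hT : r + k + 1 ≤ T) (hm : m ≤ k + 1)
    {i : Fin K} {μ₁ μ₂ e : ℝ} (hμ₁ : ∀ u, r < u → u ≤ r + m → env.mean i u = μ₁)
    (hμ₂ : ∀ u, r + m < u → u ≤ r + k + 1 → env.mean i u = μ₂)
    (he : 0 < e) (he1 : e ≤ 1) (hμ : e ≤ |μ₁ - μ₂|) {n : ℕ}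
    (hn : 16 * (l / (2 * e ^ 2)) ≤ n)
    (h1 : n - 2 ≤ obsCount base (shift r ω) i m)
    (h2 : obsCount base (shift r ω) i m + n ≤ obsCount base (shift r ω) i (k + 1)) :
    Detects δ (history base (shift r ω) (k + 1)) := by
  have he2 : 0 < e ^ 2 := by positivity
  have he3 : e ^ 2 ≤ 1 := pow_le_one₀ he.le he1
  have hn2 : 2 ≤ n := by
    have e1 : l ≤ 2 * (l / (2 * e ^ 2)) := by
      rw [show 2 * (l / (2 * e ^ 2)) = l / e ^ 2 by field_simp]
      rw [le_div_iff₀ he2]; nlinarith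
    have : (2 : ℝ) ≤ n := by linarith
    exact_mod_cast this
  -- Only `n - 2` observations are guaranteed before the change, so both sides are estimated with `n
  -- - 2`.
  have hc : 16 * (l / (2 * e ^ 2)) ≤ ((n - 2 : ℕ) : ℝ) + 2 := by
    rw [Nat.cast_sub hn2]; push_cast; linarith
  obtain ⟨hn0, hsq⟩ := sqrt_add_sqrt_le hl2 he he1 hc
  have hn0' : 0 < n - 2 := by exact_mod_cast hn0
  have c1 := hp.obsCount_eq i hm
  have c2 := hp.obsCount_eq i (m := k + 1) le_rfl
  rw [← add_assoc] at c2
  rw [hp.detects_iff rfl rfl]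
  refine ⟨i, m, hm, by omega, by omega, ?_⟩
  have a1 := h.abs_sub_lt (i := i) (s := r) (t := r + m) (by omega) (by omega) (by omega) hμ₁
  have a2 := h.abs_sub_lt (i := i) (s := r + m) (t := r + k + 1) (by omega) (by omega) (by omega)
    hμ₂
  have g1 : n - 2 ≤ obsCount (adrBandit δ base) ω i (r + m) -
    obsCount (adrBandit δ base) ω i r := by omega
  have g2 : n - 2 ≤ obsCount (adrBandit δ base) ω i (r + k + 1) -
    obsCount (adrBandit δ base) ω i (r + m) := by omega
  unfold cutThreshold
  rw [hl]
  generalize obsCount (adrBandit δ base) ω i (r + m) - obsCount (adrBandit δ base) ω i r = n₁ at *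
  generalize obsCount (adrBandit δ base) ω i (r + k + 1) -
    obsCount (adrBandit δ base) ω i (r + m) = n₂ at *
  have mono : ∀ x : ℝ, 0 ≤ x → ∀ n' : ℕ, n - 2 ≤ n' →
      Real.sqrt (1 / (2 * (n' : ℝ)) * x) ≤ Real.sqrt (1 / (2 * ((n - 2 : ℕ) : ℝ)) * x) := by
    intro x hx n' hn'
    have : ((n - 2 : ℕ) : ℝ) ≤ n' := by exact_mod_cast hn'
    gcongr
  have b1 := mono l (by linarith) n₁ g1
  have b2 := mono l (by linarith) n₂ g2
  have b3 := mono (l - 1) (by linarith) n₁ g1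
  have b4 := mono (l - 1) (by linarith) n₂ g2
  rw [abs_lt] at a1 a2
  -- The empirical gap is at least `e` minus two deviations, and threshold plus deviations amount to
  -- at most `2 * (e / 2)`.
  rcases le_abs.1 hμ with hcase | hcase
  · refine le_trans ?_ (le_abs_self _); linarith
  · refine le_trans ?_ (neg_le_abs _); linarith

/-- An arm that is played in each block of `D` rounds is observed often. -/
theorem le_obsCount_of_monitored {alg : Strategy K} {ω : Sample K} {i : Fin K} {T D : ℕ}
    (h : ∀ t, 1 ≤ t → t + D ≤ T + 1 → ∃ t' ∈ Finset.Ico t (t + D), i ∈ played alg ω t')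
    (s n : ℕ) (hn : s + D * n ≤ T) :
    obsCount alg ω i s + n ≤ obsCount alg ω i (s + D * n) := by
  induction n with
  | zero => simp
  | succ n ih =>
    rw [mul_add, mul_one] at hn ⊢
    have ih := ih (by omega)
    obtain ⟨t', ht', hi⟩ := h (s + D * n + 1) (by omega) (by omega)
    rw [Finset.mem_Ico] at ht'
    obtain ⟨u, rfl⟩ : ∃ u, t' = u + 1 := ⟨t' - 1, by omega⟩
    have e1 := obsCount_mono alg ω i (show s + D * n ≤ u by omega)
    have e2 := obsCount_mono alg ω i (show u + 1 ≤ s + (D * n + D) by omega)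
    rw [obsCount_succ, if_pos hi] at e2
    omega

/-! ### The phases of the ADR-bandit -/

/-- The changepoints `τ 1 < … < τ M`, and the numbers `N m` of observations that suffice to detect
the change at `τ m`. -/
structure ChangeSchedule (env : Environment K) (T D M : ℕ) (l : ℝ) (e : ℕ → ℝ)
    (τ N : ℕ → ℕ) : Prop where
  τ_zero : τ 0 = 0
  τ_last : τ (M + 1) = T
  N_zero : N 0 = 0
  N_last : N (M + 1) = 0
  mean_eq : ∀ m ≤ M, ∀ u v, τ m < u → u ≤ τ (m + 1) → τ m < v → v ≤ τ (m + 1) →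
    ∀ i, env.mean i u = env.mean i v
  delay_lt : ∀ m ≤ M, τ m + D * N m < τ (m + 1)
  le_gap : ∀ m < M, τ m + D * N m + D * (N (m + 1) - 2) ≤ τ (m + 1)
  e_pos : ∀ m < M, 0 < e (m + 1)
  e_le_one : ∀ m < M, e (m + 1) ≤ 1
  e_le_jump : ∀ m < M, ∀ i, e (m + 1) ≤ env.jump i (τ (m + 1))
  le_N : ∀ m < M, 16 * (l / (2 * e (m + 1) ^ 2)) ≤ N (m + 1)

/-- Round `r` is the first one from `s` on after which the window of the ADR-bandit is empty. -/
def FirstReset (δ : ℝ) (base : Strategy K) (s r : ℕ) (ω : Sample K) : Prop :=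
  s ≤ r ∧ adrWindow δ base ω r = [] ∧ ∀ u, s ≤ u → u < r → adrWindow δ base ω u ≠ []

/-- The first round after which the restart for the `m`-th change can happen. -/
def phaseStart (τ : ℕ → ℕ) (m : ℕ) : ℕ := if m = 0 then 0 else τ m + 1

/-- Downward induction from the last phase, whose deadline is `T` because `N (M + 1) = 0`. It keeps
every prolonged phase within the horizon of the assumptions on the base algorithm. -/
theorem ChangeSchedule.le_horizon {env : Environment K} {T D M : ℕ} {l : ℝ} {e : ℕ → ℝ}
    {τ N : ℕ → ℕ} (hs : ChangeSchedule env T D M l e τ N) (m : ℕ) (hm : m ≤ M) :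
    τ (m + 1) + D * N (m + 1) ≤ T := by
  obtain ⟨j, rfl⟩ := Nat.exists_eq_add_of_le hm
  induction j generalizing m with
  | zero => simp [hs.N_last, hs.τ_last]
  | succ j ih =>
    rw [← add_assoc, add_right_comm] at hs
    have := ih (m + 1) hs (by omega)
    have := hs.delay_lt (m + 1) (by omega)
    omega

theorem ChangeSchedule.le_of_phaseStart_le {env : Environment K} {T D M : ℕ} {l : ℝ} {e : ℕ → ℝ}
    {τ N : ℕ → ℕ} (hs : ChangeSchedule env T D M l e τ N) {m r : ℕ}
    (h : phaseStart τ m ≤ r) : τ m ≤ r := by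
  unfold phaseStart at h
  split_ifs at h with h0
  · subst h0; rw [hs.τ_zero]; omega
  · omega

/-- The deterministic core, by induction on the round. A reset before the next change would be a
false alarm; one after it opens the next phase; and no reset by the deadline would contradict the
guaranteed detection. -/
theorem exists_phase {env : Environment K} {base : Strategy K} {δ l : ℝ} {T D M : ℕ}
    {e : ℕ → ℝ} {τ N : ℕ → ℕ} (hs : ChangeSchedule env T D M l e τ N) {ω : Sample K}
    (h : Concentrated env (adrBandit δ base) T (l - 1) ω) (hl : Real.log (1 / δ) = l)
    (hl2 : 2 ≤ l)
    (hmon : ∀ r, ∃ i : Fin K, ∀ t, 1 ≤ t → t + D ≤ T + 1 →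
      ∃ t' ∈ Finset.Ico t (t + D), i ∈ played base (shift r ω) t')
    {t : ℕ} (ht : t < T) :
    ∃ m ≤ M, ∃ r, FirstReset δ base (phaseStart τ m) r ω ∧ r ≤ τ m + D * N m ∧
      InPhase δ base ω r t ∧ t < τ (m + 1) + D * N (m + 1) := by
  have hlast := hs.le_horizon
  induction t with
  | zero =>
    refine ⟨0, by omega, 0, ⟨by simp [phaseStart], adrWindow_zero .., by omega⟩, by omega,
      ⟨le_rfl, fun s _ h2 => ?_⟩, ?_⟩
    · obtain rfl : s = 0 := by omega
      rfl
    · have := hs.delay_lt 0 (by omega); omega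
  | succ t ih =>
    obtain ⟨m, hm, r, hr, hrE, hph, htE⟩ := ih (by omega)
    have hdm := hs.delay_lt m hm
    have hrs := hs.le_of_phaseStart_le hr.1
    obtain ⟨k, rfl⟩ := Nat.exists_eq_add_of_le hph.1
    rcases hph.succ_or with ⟨hd, hph'⟩ | ⟨hd, hph'⟩
    · refine ⟨m, hm, r, hr, hrE, hph', ?_⟩
      -- Without a reset the deadline is hit exactly, with `D * N (m + 1)` rounds played after the
      -- change: enough for `N (m + 1)` observations of the monitored arm.
      by_contra! hcon
      have hE : r + k + 1 = τ (m + 1) + D * N (m + 1) := by omega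
      have hmM : m < M := by
        by_contra! hMm
        obtain rfl : m = M := by omega
        rw [hs.N_last, hs.τ_last] at hE
        omega
      refine hd ?_
      obtain ⟨i, hi⟩ := hmon r
      have hgap := hs.le_gap m hmM
      obtain ⟨q, hq⟩ := Nat.exists_eq_add_of_le (show r ≤ τ (m + 1) by omega)
      have hd' := hs.delay_lt (m + 1) hmM
      refine h.detects hl hl2 hph (by omega) (m := q) (i := i) (by omega)
        (μ₁ := env.mean i (τ (m + 1))) (μ₂ := env.mean i (τ (m + 1) + 1)) (e := e (m + 1))
        (n := N (m + 1))
        (fun u h1 h2 => hs.mean_eq m hm _ _ (by omega) (by omega) (by omega) (by omega) i)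
        (fun u h1 h2 => hs.mean_eq (m + 1) hmM _ _ (by omega) (by omega) (by omega) (by omega) i)
        (hs.e_pos m hmM) (hs.e_le_one m hmM) (hs.e_le_jump m hmM i) (hs.le_N m hmM) ?_ ?_
      · have h1 := le_obsCount_of_monitored hi 0 (N (m + 1) - 2) (by omega)
        have h2 := obsCount_mono base (shift r ω) i (show 0 + D * (N (m + 1) - 2) ≤ q by omega)
        omega
      · have h1 := le_obsCount_of_monitored hi q (N (m + 1)) (by omega)
        rwa [show q + D * N (m + 1) = k + 1 by omega] at h1
    · have hlate : τ (m + 1) < r + k + 1 := by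
        by_contra! hle
        exact h.not_detects (by linarith) hph (by omega) (fun i u v h1 h2 h3 h4 =>
          hs.mean_eq m hm u v (by omega) (by omega) (by omega) (by omega) i) hd
      have hmM : m < M := by
        by_contra! hMm
        obtain rfl : m = M := by omega
        rw [hs.τ_last] at hlate
        omega
      have hd' := hs.delay_lt (m + 1) hmM
      refine ⟨m + 1, hmM, r + k + 1, ⟨?_, ?_, fun u h1 h2 h3 => ?_⟩, by omega, hph', by omega⟩
      · simp [phaseStart]; omega
      · simpa using hph'.2 _ le_rfl le_rfl
      · simp only [phaseStart, Nat.add_eq_zero_iff, one_ne_zero, and_false, if_false] at h1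
        have := hph.2 u (by omega) (by omega)
        rw [h3] at this
        simp at this
        omega

/-! ### Means and regret -/

theorem Environment.mean_nonneg (env : Environment K) (i : Fin K) (t : ℕ) : 0 ≤ env.mean i t :=
  integral_nonneg_of_ae ((env.reward_mem_Icc t).mono fun _ hx => (hx i).1)

theorem Environment.mean_le_one (env : Environment K) (i : Fin K) (t : ℕ) : env.mean i t ≤ 1 := by
  have h : ∀ᵐ x ∂(env.law t), x i ∈ Set.Icc (0 : ℝ) 1 :=
    (env.reward_mem_Icc t).mono fun x hx => hx i
  have h1 := integral_mono_ae (Integrable.of_mem_Icc 0 1 (measurable_pi_apply i).aemeasurable h)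
    (integrable_const (1 : ℝ)) (h.mono fun _ hx => hx.2)
  simpa [Environment.mean] using h1

theorem Environment.jump_le_one (env : Environment K) (i : Fin K) (t : ℕ) : env.jump i t ≤ 1 := by
  have h1 := env.mean_nonneg i t
  have h2 := env.mean_nonneg i (t + 1)
  have h3 := env.mean_le_one i t
  have h4 := env.mean_le_one i (t + 1)
  exact abs_le.2 ⟨by linarith, by linarith⟩

theorem instantRegret_nonneg (env : Environment K) {L : ℕ} (t : ℕ) {I : Finset (Fin K)}
    (hI : I.card = L) : 0 ≤ instantRegret env L t I :=
  sub_nonneg.2 (le_ciSup (f := fun J : {J : Finset (Fin K) // J.card = L} =>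
    ∑ i ∈ J.1, env.mean i t) (Set.finite_range _).bddAbove ⟨I, hI⟩)

theorem instantRegret_le (env : Environment K) {L : ℕ} (t : ℕ) {I : Finset (Fin K)}
    (hI : I.card = L) : instantRegret env L t I ≤ L := by
  have : Nonempty {J : Finset (Fin K) // J.card = L} := ⟨⟨I, hI⟩⟩
  have h1 : 0 ≤ ∑ i ∈ I, env.mean i t := Finset.sum_nonneg fun i _ => env.mean_nonneg i t
  have h2 : (⨆ J : {J : Finset (Fin K) // J.card = L}, ∑ i ∈ J.1, env.mean i t) ≤ L := by
    refine ciSup_le fun J => ?_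
    calc ∑ i ∈ J.1, env.mean i t ≤ ∑ i ∈ J.1, 1 :=
          Finset.sum_le_sum fun i _ => env.mean_le_one i t
      _ = L := by simp [J.2]
  unfold instantRegret
  linarith

theorem card_played {L : ℕ} {alg : Strategy K} (h : IsBanditAlgorithm L alg) (ω : Sample K)
    (t : ℕ) : (played alg ω t).card = L := h.card_eq _ _

theorem regret_eq_sum_range (env : Environment K) (L : ℕ) (alg : Strategy K) (S : ℕ)
    (ω : Sample K) : regret env L alg S ω =
      ∑ k ∈ Finset.range S, instantRegret env L (k + 1) (played alg ω (k + 1)) := by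
  rw [regret, Finset.range_eq_Ico, Finset.sum_Ico_add' (fun t =>
    instantRegret env L t (played alg ω t)) 0 S 1]
  rfl

theorem regret_nonneg (env : Environment K) {L : ℕ} {alg : Strategy K}
    (h : IsBanditAlgorithm L alg) (S : ℕ) (ω : Sample K) : 0 ≤ regret env L alg S ω :=
  Finset.sum_nonneg fun t _ => instantRegret_nonneg env t (card_played h ω t)

theorem regret_le (env : Environment K) {L : ℕ} {alg : Strategy K}
    (h : IsBanditAlgorithm L alg) (S : ℕ) (ω : Sample K) : regret env L alg S ω ≤ L * S := by
  calc regret env L alg S ω ≤ ∑ t ∈ Finset.Icc 1 S, (L : ℝ) :=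
        Finset.sum_le_sum fun t _ => instantRegret_le env t (card_played h ω t)
    _ = L * S := by simp [mul_comm]

theorem measurable_regret (env : Environment K) {L : ℕ} {alg : Strategy K}
    (h : IsBanditAlgorithm L alg) (S : ℕ) : Measurable (regret env L alg S) :=
  Finset.measurable_fun_sum _ fun t _ =>
    (Measurable.of_discrete (f := instantRegret env L t)).comp (measurable_played h t)

theorem integrable_of_mem_Icc_of_measurable {Ω : Type*} [MeasurableSpace Ω] {μ : Measure Ω}
    [IsFiniteMeasure μ] {f : Ω → ℝ} {b : ℝ} (hf : Measurable f) (h0 : ∀ ω, 0 ≤ f ω)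
    (hb : ∀ ω, f ω ≤ b) : Integrable f μ :=
  Integrable.of_mem_Icc 0 b hf.aemeasurable (Filter.Eventually.of_forall fun ω => ⟨h0 ω, hb ω⟩)

theorem integrable_regret (env env' : Environment K) {L : ℕ} {alg : Strategy K}
    (h : IsBanditAlgorithm L alg) (S : ℕ) : Integrable (regret env L alg S) (runMeasure env') :=
  integrable_of_mem_Icc_of_measurable (measurable_regret env h S) (regret_nonneg env h S)
    (regret_le env h S)

/-! ### First resets -/

theorem adrWindow_congr (δ : ℝ) (base : Strategy K) {ω ω' : Sample K} {t : ℕ}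
    (h : ∀ s, 1 ≤ s → s ≤ t → ω s = ω' s) : adrWindow δ base ω t = adrWindow δ base ω' t := by
  unfold adrWindow
  rw [history_congr _ h]

/-- The event is decided by the rounds up to `r`, as the independence argument requires. -/
theorem firstReset_splice (δ : ℝ) (base : Strategy K) (s r : ℕ) (ω ω' : Sample K) :
    FirstReset δ base s r (splice r ω ω') ↔ FirstReset δ base s r ω := by
  have h : ∀ u ≤ r, adrWindow δ base (splice r ω ω') u = adrWindow δ base ω u := fun u hu =>
    adrWindow_congr δ base fun v _ hv => by simp [splice, hv.trans hu]
  unfold FirstReset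
  rw [h r le_rfl]
  refine and_congr_right fun _ => and_congr_right fun _ => forall_congr' fun u => ?_
  refine imp_congr_right fun _ => imp_congr_right fun hu => ?_
  rw [h u hu.le]

theorem measurableSet_adrWindow_eq_nil {L : ℕ} {base : Strategy K}
    (h : IsBanditAlgorithm L base) (δ : ℝ) (t : ℕ) :
    MeasurableSet {ω | adrWindow δ base ω t = []} := by
  have h1 : Measurable fun (ω : Sample K) (k : Fin t) => obsAt (adrBandit δ base) ω (k + 1) :=
    measurable_pi_lambda _ fun k => measurable_obsAt (h.adrBandit δ) _
  have := h1 (measurableSet_window_length δ t 0)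
  convert this using 1
  ext ω
  simp [adrWindow, history_eq_ofFn]

theorem measurableSet_firstReset {L : ℕ} {base : Strategy K}
    (h : IsBanditAlgorithm L base) (δ : ℝ) (s r : ℕ) :
    MeasurableSet {ω | FirstReset δ base s r ω} := by
  have h1 := measurableSet_adrWindow_eq_nil h δ
  have : {ω | FirstReset δ base s r ω} = {_ω | s ≤ r} ∩ ({ω | adrWindow δ base ω r = []} ∩
      ⋂ u, ⋂ (_ : s ≤ u), ⋂ (_ : u < r), {ω | adrWindow δ base ω u = []}ᶜ) := by
    ext ω; simp [FirstReset]
  rw [this]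
  exact (MeasurableSet.const _).inter ((h1 r).inter (MeasurableSet.iInter fun u =>
    MeasurableSet.iInter fun _ => MeasurableSet.iInter fun _ => (h1 u).compl))

theorem sum_measureReal_firstReset_le (env : Environment K) {L : ℕ} {base : Strategy K}
    (h : IsBanditAlgorithm L base) (δ : ℝ) (s : ℕ) (R : Finset ℕ) :
    ∑ r ∈ R, (runMeasure env).real {ω | FirstReset δ base s r ω} ≤ 1 := by
  rw [← measureReal_biUnion_finset _ fun r _ => measurableSet_firstReset h δ s r]
  · exact measureReal_le_one
  · intro r _ r' _ hne
    refine Set.disjoint_left.2 fun ω h1 h2 => ?_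
    rcases lt_or_gt_of_ne hne with hlt | hlt
    · exact h2.2.2 r h1.1 hlt h1.2.1
    · exact h1.2.2 r' h2.1 hlt h2.2.1

/-- The regret of the base algorithm restarted after round `r`, on the event that `r` is the first
reset from `s` on. -/
theorem integral_firstReset_mul_regret (env : Environment K) {L : ℕ} {base : Strategy K}
    (h : IsBanditAlgorithm L base) (δ : ℝ) (s r S : ℕ) :
    ∫ ω, {ω | FirstReset δ base s r ω}.indicator 1 ω *
        regret (env.shift r) L base S (shift r ω) ∂(runMeasure env) =
      (runMeasure env).real {ω | FirstReset δ base s r ω} *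
        expectedRegret (env.shift r) L base S := by
  have hm := measurableSet_firstReset h δ s r
  rw [integral_mul_shift env r (f := {ω | FirstReset δ base s r ω}.indicator 1)
    (measurable_one.indicator hm) (measurable_regret (env.shift r) h S) ?_ ?_,
    integral_indicator_one hm]
  · rfl
  · intro ω ω'
    by_cases hr : FirstReset δ base s r ω <;>
      simp [Set.indicator, Set.mem_ofPred_eq, firstReset_splice, hr]
  · intro ω ω'
    refine Finset.sum_congr rfl fun t ht => ?_
    rw [Finset.mem_Icc] at ht
    rw [played_congr base ht.1 fun u hu _ => ?_]
    have : ¬ r + u ≤ r := by omega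
    simp [shift, splice, this]

/-! ### Decomposition of the regret into phases -/

/-- Each round's regret occurs in the term of its own phase, and all other terms are nonnegative.
Every run is prolonged to a deadline fixed once `m` is given, so the random end of a phase does not
enter. -/
theorem regret_le_sum_phases {env : Environment K} {L : ℕ} {base : Strategy K}
    (h : IsBanditAlgorithm L base) {δ l : ℝ} {T D M : ℕ}
    {e : ℕ → ℝ} {τ N : ℕ → ℕ} (hs : ChangeSchedule env T D M l e τ N) {ω : Sample K}
    (hc : Concentrated env (adrBandit δ base) T (l - 1) ω) (hl : Real.log (1 / δ) = l)
    (hl2 : 2 ≤ l)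
    (hmon : ∀ r, ∃ i : Fin K, ∀ t, 1 ≤ t → t + D ≤ T + 1 →
      ∃ t' ∈ Finset.Ico t (t + D), i ∈ played base (shift r ω) t') :
    regret env L (adrBandit δ base) T ω ≤ ∑ m ∈ Finset.range (M + 1),
      ∑ r ∈ Finset.Icc (phaseStart τ m) (τ m + D * N m),
        {ω | FirstReset δ base (phaseStart τ m) r ω}.indicator 1 ω *
          regret (env.shift r) L base (τ (m + 1) + D * N (m + 1) - r) (shift r ω) := by
  let g : ℕ → ℕ → ℝ := fun r k =>
    instantRegret (env.shift r) L (k + 1) (played base (shift r ω) (k + 1))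
  have hg : ∀ r k, 0 ≤ g r k := fun r k => instantRegret_nonneg _ _ (card_played h _ _)
  let χ : ℕ → ℕ → ℝ := fun m r => {ω | FirstReset δ base (phaseStart τ m) r ω}.indicator 1 ω
  have hχ : ∀ m r, 0 ≤ χ m r := fun m r => Set.indicator_nonneg (fun _ _ => zero_le_one) _
  let w : ℕ → ℕ → ℕ → ℝ := fun m r t =>
    χ m r * if r ≤ t ∧ t < τ (m + 1) + D * N (m + 1) then g r (t - r) else 0
  have hw : ∀ m r t, 0 ≤ w m r t := fun m r t => mul_nonneg (hχ m r) (by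
    split_ifs
    · exact hg _ _
    · exact le_rfl)
  have hround : ∀ t ∈ Finset.range T,
      instantRegret env L (t + 1) (played (adrBandit δ base) ω (t + 1)) ≤
      ∑ m ∈ Finset.range (M + 1),
        ∑ r ∈ Finset.Icc (phaseStart τ m) (τ m + D * N m), w m r t := by
    intro t ht
    obtain ⟨m, hm, r, hr, hrE, hph, htE⟩ := exists_phase hs hc hl hl2 hmon (Finset.mem_range.1 ht)
    obtain ⟨k, rfl⟩ := Nat.exists_eq_add_of_le hph.1
    have e1 : w m r (r + k) =
        instantRegret env L (r + k + 1) (played (adrBandit δ base) ω (r + k + 1)) := by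
      simp only [w, χ, g]
      have hmem : ω ∈ {ω | FirstReset δ base (phaseStart τ m) r ω} := hr
      rw [if_pos ⟨hph.1, htE⟩, Set.indicator_of_mem hmem, hph.played_eq, Nat.add_sub_cancel_left]
      simp only [Pi.one_apply, one_mul]
      rfl
    rw [← e1]
    have s1 : ∑ r' ∈ Finset.Icc (phaseStart τ m) (τ m + D * N m), w m r' (r + k) ≤ _ :=
      Finset.single_le_sum
      (f := fun m => ∑ r' ∈ Finset.Icc (phaseStart τ m) (τ m + D * N m), w m r' (r + k))
      (fun m _ => Finset.sum_nonneg fun r _ => hw _ _ _)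
      (Finset.mem_range.2 (Nat.lt_add_one_of_le hm))
    have s2 : w m r (r + k) ≤ _ := Finset.single_le_sum (f := fun r' => w m r' (r + k))
      (fun r' _ => hw _ _ _) (Finset.mem_Icc.2 ⟨hr.1, hrE⟩)
    exact s2.trans s1
  rw [regret_eq_sum_range]
  refine (Finset.sum_le_sum hround).trans ?_
  rw [Finset.sum_comm]
  refine Finset.sum_le_sum fun m _ => ?_
  rw [Finset.sum_comm]
  refine Finset.sum_le_sum fun r _ => ?_
  simp only [w, ← Finset.mul_sum]
  refine mul_le_mul_of_nonneg_left ?_ (hχ m r)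
  rw [← Finset.sum_filter, regret_eq_sum_range]
  calc _ ≤ ∑ t ∈ Finset.Ico r (τ (m + 1) + D * N (m + 1)), g r (t - r) :=
        Finset.sum_le_sum_of_subset_of_nonneg (fun t ht => by
          rw [Finset.mem_filter] at ht
          exact Finset.mem_Ico.2 ht.2) fun t _ _ => hg _ _
    _ = _ := by
        rw [Finset.sum_Ico_eq_sum_range]
        simp only [Nat.add_sub_cancel_left, g]

/-- Conditioning on concentration would destroy independence. Instead the phase sum is integrated
over the whole space, and the trivial bound `L * T` is added on the exceptional event. -/
theorem expectedRegret_adrBandit_le {env : Environment K} {L : ℕ} {base : Strategy K}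
    (h : IsBanditAlgorithm L base) {δ l : ℝ} {T D M : ℕ}
    {e : ℕ → ℝ} {τ N : ℕ → ℕ} (hs : ChangeSchedule env T D M l e τ N)
    (hl : Real.log (1 / δ) = l) (hl2 : 2 ≤ l) (hmon : MonitoringConsistent T D base)
    {V : ℕ → ℝ} (hV0 : ∀ m ≤ M, 0 ≤ V m)
    (hV : ∀ m ≤ M, ∀ r, phaseStart τ m ≤ r → r ≤ τ m + D * N m →
      expectedRegret (env.shift r) L base (τ (m + 1) + D * N (m + 1) - r) ≤ V m) :
    expectedRegret env L (adrBandit δ base) T ≤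
      ∑ m ∈ Finset.range (M + 1), V m +
        L * T * (2 * K * T ^ 2 * Real.exp (-(l - 1))) := by
  obtain ⟨B, hBm, hB, hBc⟩ := exists_concentrated env (h.adrBandit δ) T (y := l - 1) (by linarith)
  -- Monitoring consistency in each shifted environment covers all countably many restart rounds on
  -- one almost sure event.
  have hmon' : ∀ᵐ ω ∂(runMeasure env), ∀ r, ∃ i : Fin K, ∀ t, 1 ≤ t → t + D ≤ T + 1 →
      ∃ t' ∈ Finset.Ico t (t + D), i ∈ played base (shift r ω) t' := by
    rw [ae_all_iff]
    intro r
    have := hmon (env.shift r)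
    rw [← map_shift_runMeasure] at this
    exact ae_of_ae_map (measurable_shift r).aemeasurable this
  let w : ℕ → ℕ → Sample K → ℝ := fun m r ω =>
    {ω | FirstReset δ base (phaseStart τ m) r ω}.indicator 1 ω *
      regret (env.shift r) L base (τ (m + 1) + D * N (m + 1) - r) (shift r ω)
  have hw0 : ∀ m r ω, 0 ≤ w m r ω := fun m r ω =>
    mul_nonneg (Set.indicator_nonneg (fun _ _ => zero_le_one) _) (regret_nonneg _ h _ _)
  have hwi : ∀ m r, Integrable (w m r) (runMeasure env) := fun m r => by
    refine integrable_of_mem_Icc_of_measurable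
      (b := 1 * (L * (τ (m + 1) + D * N (m + 1) - r : ℕ))) ?_ (hw0 m r) fun ω => ?_
    · exact (measurable_one.indicator (measurableSet_firstReset h δ _ r)).mul
        ((measurable_regret _ h _).comp (measurable_shift r))
    · refine mul_le_mul ?_ (regret_le _ h _ _) (regret_nonneg _ h _ _) zero_le_one
      exact Set.indicator_le' (fun _ _ => le_rfl) (fun _ _ => zero_le_one) ω
  have hsi : Integrable (fun ω => ∑ m ∈ Finset.range (M + 1),
      ∑ r ∈ Finset.Icc (phaseStart τ m) (τ m + D * N m), w m r ω) (runMeasure env) :=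
    integrable_finsetSum _ fun m _ => integrable_finsetSum _ fun r _ => hwi m r
  have hBi : Integrable (B.indicator fun _ => (L * T : ℝ)) (runMeasure env) :=
    (integrable_const _).indicator hBm
  have hbound : ∀ᵐ ω ∂(runMeasure env), regret env L (adrBandit δ base) T ω ≤
      (∑ m ∈ Finset.range (M + 1),
        ∑ r ∈ Finset.Icc (phaseStart τ m) (τ m + D * N m), w m r ω) +
        B.indicator (fun _ => (L * T : ℝ)) ω := by
    filter_upwards [hmon'] with ω hω
    by_cases hωB : ω ∈ B
    · rw [Set.indicator_of_mem hωB]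
      have := regret_le env (h.adrBandit δ) T ω
      have : 0 ≤ ∑ m ∈ Finset.range (M + 1),
        ∑ r ∈ Finset.Icc (phaseStart τ m) (τ m + D * N m), w m r ω :=
          Finset.sum_nonneg fun m _ => Finset.sum_nonneg fun r _ => hw0 m r ω
      linarith
    · rw [Set.indicator_of_notMem hωB, add_zero]
      exact regret_le_sum_phases h hs (hBc ω hωB) hl hl2 hω
  have h1 := integral_mono_ae (integrable_regret env env (h.adrBandit δ) T) (hsi.add hBi) hbound
  rw [integral_add' hsi hBi, integral_finsetSum _ fun m _ => integrable_finsetSum _ fun r _ =>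
    hwi m r, integral_indicator hBm, setIntegral_const, smul_eq_mul] at h1
  refine h1.trans (add_le_add (Finset.sum_le_sum fun m hm => ?_) ?_)
  · have hm : m ≤ M := Nat.lt_succ_iff.1 (Finset.mem_range.1 hm)
    rw [integral_finsetSum _ fun r _ => hwi m r]
    calc ∑ r ∈ Finset.Icc (phaseStart τ m) (τ m + D * N m), ∫ ω, w m r ω ∂(runMeasure env)
        ≤ ∑ r ∈ Finset.Icc (phaseStart τ m) (τ m + D * N m),
          (runMeasure env).real {ω | FirstReset δ base (phaseStart τ m) r ω} * V m := by
          refine Finset.sum_le_sum fun r hr => ?_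
          rw [Finset.mem_Icc] at hr
          simp only [w]
          rw [integral_firstReset_mul_regret env h]
          exact mul_le_mul_of_nonneg_left (hV m hm r hr.1 hr.2) measureReal_nonneg
      _ ≤ 1 * V m := by
          rw [← Finset.sum_mul]
          exact mul_le_mul_of_nonneg_right (sum_measureReal_firstReset_le env h δ _ _) (hV0 m hm)
      _ = V m := one_mul _
  · rw [mul_comm]
    exact mul_le_mul_of_nonneg_left hB (by positivity)

/-! ### The regret in one phase -/

/-- The run meets at most the one change at `τ (m + 1)`, and only the `D * N (m + 1)` rounds between
it and the deadline feel the jump. In the last phase there are none. -/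
theorem sum_drift_shift_le [Nonempty (Fin K)] {env : Environment K} {T D M : ℕ} {l : ℝ}
    {e : ℕ → ℝ} {τ N : ℕ → ℕ} (hs : ChangeSchedule env T D M l e τ N) {J : ℕ → ℝ}
    (hJ : ∀ m < M, ∀ i, env.jump i (τ (m + 1)) ≤ J (m + 1)) (hJ0 : ∀ m < M, 0 ≤ J (m + 1))
    {m : ℕ} (hm : m ≤ M) {r : ℕ} (hr : phaseStart τ m ≤ r) (hr' : r ≤ τ m + D * N m) :
    ∑ t ∈ Finset.Icc 1 (τ (m + 1) + D * N (m + 1) - r), (env.shift r).drift t ≤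
      D * N (m + 1) * J (m + 1) := by
  have hrs := hs.le_of_phaseStart_le hr
  have hd := hs.delay_lt m hm
  have hterm : ∀ s, 1 ≤ s → r + s < τ (m + 1) + D * N (m + 1) →
      (⨆ i, (env.shift r).jump i s) ≤ if s = τ (m + 1) - r then J (m + 1) else 0 := by
    intro s hs1 hs2
    refine ciSup_le fun i => ?_
    change env.jump i (r + s) ≤ _
    split_ifs with hcase
    · have hmM : m < M := by
        by_contra! hMm
        obtain rfl : m = M := by omega
        rw [hs.N_last] at hs2; omega
      rw [hcase, Nat.add_sub_cancel' (by omega)]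
      exact hJ m hmM i
    · refine le_of_eq ?_
      unfold Environment.jump
      rw [abs_eq_zero, sub_eq_zero]
      rcases Nat.lt_or_ge (r + s) (τ (m + 1)) with hlt | hge
      · exact hs.mean_eq m hm _ _ (by omega) (by omega) (by omega) (by omega) i
      · have hmM : m < M := by
          by_contra! hMm
          obtain rfl : m = M := by omega
          rw [hs.N_last] at hs2; omega
        have := hs.delay_lt (m + 1) hmM
        exact hs.mean_eq (m + 1) hmM _ _ (by omega) (by omega) (by omega) (by omega) i
  have hdrift : ∀ t ∈ Finset.Icc 1 (τ (m + 1) + D * N (m + 1) - r), (env.shift r).drift t ≤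
      if τ (m + 1) - r < t then J (m + 1) else 0 := by
    intro t ht
    rw [Finset.mem_Icc] at ht
    calc (env.shift r).drift t ≤
        ∑ s ∈ Finset.Ico 1 t, if s = τ (m + 1) - r then J (m + 1) else 0 :=
          Finset.sum_le_sum fun s hs' => by
            rw [Finset.mem_Ico] at hs'
            exact hterm s hs'.1 (by omega)
      _ = _ := by
        rw [Finset.sum_ite_eq']
        congr 1
        simp only [Finset.mem_Ico, eq_iff_iff]
        omega
  refine (Finset.sum_le_sum hdrift).trans_eq ?_
  rw [← Finset.sum_filter, Finset.sum_const, nsmul_eq_mul]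
  have : Finset.filter (fun t => τ (m + 1) - r < t)
      (Finset.Icc 1 (τ (m + 1) + D * N (m + 1) - r)) =
      Finset.Ioc (τ (m + 1) - r) (τ (m + 1) + D * N (m + 1) - r) := by
    ext t; simp only [Finset.mem_filter, Finset.mem_Icc, Finset.mem_Ioc]; omega
  rw [this, Nat.card_Ioc, show τ (m + 1) + D * N (m + 1) - r - (τ (m + 1) - r) = D * N (m + 1) by
    omega]
  push_cast
  rfl

theorem expectedRegret_shift_le [Nonempty (Fin K)] {env : Environment K} {T D M L : ℕ} {l : ℝ}
    {e : ℕ → ℝ} {τ N : ℕ → ℕ} (hs : ChangeSchedule env T D M l e τ N) {J : ℕ → ℝ}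
    (hJ : ∀ m < M, ∀ i, env.jump i (τ (m + 1)) ≤ J (m + 1)) (hJ0 : ∀ m < M, 0 ≤ J (m + 1))
    {base : Strategy K} {C C' : ℝ} (hreg : HasDTRegret L T C base) (hC : C ≤ C') (hC' : 0 ≤ C')
    {m : ℕ} (hm : m ≤ M) {r : ℕ} (hr : phaseStart τ m ≤ r) (hr' : r ≤ τ m + D * N m) :
    expectedRegret (env.shift r) L base (τ (m + 1) + D * N (m + 1) - r) ≤
      C' * (Real.sqrt (L * K * (τ (m + 1) - τ m + D * N (m + 1))) +
        L * (D * N (m + 1) * J (m + 1))) := by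
  have hrs := hs.le_of_phaseStart_le hr
  have hd := hs.delay_lt m hm
  have hT := hs.le_horizon m hm
  have h1 := hreg (env.shift r) (τ (m + 1) + D * N (m + 1) - r)
    (Finset.mem_Icc.2 ⟨by omega, by omega⟩)
  have h2 := sum_drift_shift_le hs hJ hJ0 hm hr hr'
  have h3 : 0 ≤ ∑ t ∈ Finset.Icc 1 (τ (m + 1) + D * N (m + 1) - r), (env.shift r).drift t :=
    Finset.sum_nonneg fun t _ => Finset.sum_nonneg fun s _ => Real.iSup_nonneg fun i => abs_nonneg _
  have h4 : ((τ (m + 1) + D * N (m + 1) - r : ℕ) : ℝ) ≤ τ (m + 1) - τ m + D * N (m + 1) := by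
    rw [Nat.cast_sub (by omega)]
    have : (τ m : ℝ) ≤ r := by exact_mod_cast hrs
    push_cast
    linarith
  refine h1.trans ?_
  gcongr

/-! ### The schedule of an environment with globally abrupt changes -/

/-- Detection is governed by the smallest jump, drift by the largest; `Cab` links the two. The gap
condition then trades the drift `D * N * e` for the square root of the preceding gap. -/
theorem exists_schedule [Nonempty (Fin K)] {env : Environment K} {T D M : ℕ} {Cab : ℝ}
    (h : GloballyAbrupt env T D M Cab) (hM : 1 ≤ M) (hD : 1 ≤ D) :
    ∃ (e : ℕ → ℝ) (τ N : ℕ → ℕ), 2 ≤ T ∧ 0 ≤ Cab ∧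
      ChangeSchedule env T D M (Real.log ((T : ℝ) ^ 3)) e τ N ∧
      (∀ m < M, ∀ i, env.jump i (τ (m + 1)) ≤ Cab * e (m + 1)) ∧
      ∀ m < M, (D * N (m + 1) : ℝ) ≤ τ (m + 1) - τ m ∧
        D * N (m + 1) * e (m + 1) ≤
          3 * Real.sqrt (D * Real.log ((T : ℝ) ^ 3) * (τ (m + 1) - τ m)) := by
  classical
  obtain ⟨τ, hτ0, hτT, hmono, hcp, hgap⟩ := h.exists_enumeration
  have hcp' : ∀ m < M, τ (m + 1) ∈ changepoints env T := fun m hm => by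
    rw [← hcp]; exact ⟨m + 1, ⟨by omega, by omega⟩, rfl⟩
  have hT2 : 2 ≤ T := by
    obtain ⟨h1, h2, -⟩ := hcp' 0 (by omega); omega
  set l := Real.log ((T : ℝ) ^ 3) with hl
  have hl2 : 2 ≤ l := by
    have h1 : Real.log 2 ≤ Real.log T := Real.log_le_log (by norm_num) (by exact_mod_cast hT2)
    have h2 := Real.log_two_gt_d9
    rw [hl, Real.log_pow]; push_cast; linarith
  let e : ℕ → ℝ := fun m => ⨅ i, env.jump i (τ m)
  have hmin : ∀ m, ∃ i, env.jump i (τ m) = e m := fun m => exists_eq_ciInf_of_finite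
  have he_le : ∀ m i, e m ≤ env.jump i (τ m) := fun m i =>
    ciInf_le (Set.finite_range _).bddBelow i
  have hCab : 0 ≤ Cab := by
    obtain ⟨i⟩ := ‹Nonempty (Fin K)›
    have h1 := (h.ratio_le _ (hcp' 0 (by omega)) i i).2
    exact (div_nonneg (abs_nonneg _) (abs_nonneg _)).trans h1
  have he_pos : ∀ m < M, 0 < e (m + 1) := fun m hm => by
    obtain ⟨i, hi⟩ := hmin (m + 1)
    rw [← hi]
    exact lt_of_le_of_ne (abs_nonneg _) (h.ratio_le _ (hcp' m hm) i i).1.symm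
  have he_one : ∀ m, e m ≤ 1 := fun m => by
    obtain ⟨i, hi⟩ := hmin m
    rw [← hi]; exact env.jump_le_one i _
  let U : ℕ → ℝ := fun m => l / (2 * e m ^ 2)
  have hU : ∀ m < M, 1 ≤ U (m + 1) := fun m hm => by
    have h1 := he_pos m hm
    have h2 : e (m + 1) ^ 2 ≤ 1 := pow_le_one₀ h1.le (he_one _)
    simp only [U]
    rw [le_div_iff₀ (by positivity)]; linarith
  -- The value `0` elsewhere encodes that neither the start nor the horizon needs detecting.
  let N : ℕ → ℕ := fun m => if 1 ≤ m ∧ m ≤ M then ⌈16 * U m⌉₊ else 0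
  have hN : ∀ m < M, N (m + 1) = ⌈16 * U (m + 1)⌉₊ := fun m hm => if_pos ⟨by omega, by omega⟩
  have hN1 : ∀ m < M, 16 * U (m + 1) ≤ N (m + 1) := fun m hm => by
    rw [hN m hm]; exact Nat.le_ceil _
  have hN2 : ∀ m < M, (N (m + 1) : ℝ) < 16 * U (m + 1) + 1 := fun m hm => by
    rw [hN m hm]; exact Nat.ceil_lt_add_one (by linarith [hU m hm])
  have hgap1 : ∀ m < M, 32 * D * U (m + 1) ≤ (τ (m + 1) : ℝ) - τ m := fun m hm => by
    have h1 := (hgap (m + 1) ⟨by omega, by omega⟩).1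
    rw [Nat.add_sub_cancel] at h1
    exact h1
  have hgap2 : ∀ m < M, 32 * D * U (m + 1) ≤ (τ (m + 1 + 1) : ℝ) - τ (m + 1) := fun m hm =>
    (hgap (m + 1) ⟨by omega, by omega⟩).2
  have hD' : (1 : ℝ) ≤ D := by exact_mod_cast hD
  have hDN : ∀ m < M, (D * N (m + 1) : ℝ) ≤ D * (17 * U (m + 1)) := fun m hm => by
    have h1 := hN2 m hm
    have h2 := hU m hm
    gcongr
    linarith
  have hlt : ∀ m ≤ M, τ m < τ (m + 1) := fun m hm =>
    hmono ⟨by omega, by omega⟩ ⟨by omega, by omega⟩ (by omega)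
  refine ⟨e, τ, N, hT2, hCab, ⟨hτ0, hτT, if_neg (by omega), if_neg (by omega), ?_, ?_, ?_, he_pos,
    fun m _ => he_one _, fun m _ i => he_le _ i, hN1⟩, ?_, ?_⟩
  · have hstep : ∀ m ≤ M, ∀ u, τ m < u → u < τ (m + 1) → ∀ i,
        env.mean i u = env.mean i (u + 1) := by
      intro m hm u h1 h2 i
      by_contra hne
      have huT : u < T := by
        have := hmono.monotoneOn (a := m + 1) (b := M + 1) ⟨by omega, by omega⟩
          ⟨by omega, by omega⟩ (by omega)
        omega
      have hu : u ∈ changepoints env T := ⟨by omega, huT, i, hne⟩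
      rw [← hcp] at hu
      obtain ⟨m', ⟨h3, h4⟩, rfl⟩ := hu
      have h5 := (hmono.lt_iff_lt (a := m) (b := m') ⟨by omega, by omega⟩
        ⟨by omega, by omega⟩).1 h1
      have h6 := (hmono.lt_iff_lt (a := m') (b := m + 1) ⟨by omega, by omega⟩
        ⟨by omega, by omega⟩).1 h2
      omega
    have hfirst : ∀ m ≤ M, ∀ k, τ m + 1 + k ≤ τ (m + 1) → ∀ i,
        env.mean i (τ m + 1 + k) = env.mean i (τ m + 1) := by
      intro m hm k hk i
      induction k with
      | zero => rfl
      | succ k ih =>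
        rw [← ih (by omega), hstep m hm (τ m + 1 + k) (by omega) (by omega) i]; rfl
    intro m hm u v h1 h2 h3 h4 i
    obtain ⟨a, rfl⟩ := Nat.exists_eq_add_of_le (show τ m + 1 ≤ u from h1)
    obtain ⟨b, rfl⟩ := Nat.exists_eq_add_of_le (show τ m + 1 ≤ v from h3)
    rw [hfirst m hm a h2, hfirst m hm b h4]
  · intro m hm
    rcases m with _ | m
    · have : N 0 = 0 := if_neg (by omega)
      rw [this]; simpa using hlt 0 hm
    · have h1 := hDN m hm
      have h2 := hgap2 m hm
      have h3 := hU m hm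
      have h4 : (0 : ℝ) < D * U (m + 1) := by positivity
      have : (τ (m + 1) : ℝ) + D * N (m + 1) < τ (m + 1 + 1) := by nlinarith
      exact_mod_cast this
  -- The gap exceeds both `32DU m` and `32DU (m + 1)`, hence their mean. Subtracting two
  -- observations cancels the rounding up in both `N m` and `N (m + 1)`.
  · intro m hm
    have hN2' : 2 ≤ N (m + 1) := by
      have h1 := hN1 m hm
      have h2 := hU m hm
      have : (2 : ℝ) ≤ N (m + 1) := by linarith
      exact_mod_cast this
    have h1 := hN2 m hm
    have h2 := hgap1 m hm
    have h3 : (D : ℝ) * (N (m + 1) - 2) ≤ D * (16 * U (m + 1) - 1) :=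
      mul_le_mul_of_nonneg_left (by linarith) (by linarith)
    have h4 : (τ m : ℝ) + D * N m + D * (N (m + 1) - 2) ≤ τ (m + 1) := by
      rcases m with _ | m
      · have : N 0 = 0 := if_neg (by omega)
        rw [this]
        have := hU 0 hm
        have : (0 : ℝ) < D * U 1 := by positivity
        simp only [Nat.cast_zero, mul_zero, add_zero, zero_add] at *
        nlinarith
      · have h5 := hN2 m (by omega)
        have h6 := hgap2 m (by omega)
        have h7 : (D : ℝ) * N (m + 1) ≤ D * (16 * U (m + 1) + 1) := by gcongr
        nlinarith
    have h5 : ((N (m + 1) - 2 : ℕ) : ℝ) = N (m + 1) - 2 := by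
      rw [Nat.cast_sub hN2']; rfl
    rw [← h5] at h4
    exact_mod_cast h4
  · intro m hm j
    obtain ⟨i, hi⟩ := hmin (m + 1)
    have h1 := (h.ratio_le _ (hcp' m hm) i j).2
    rw [hi, div_le_iff₀ (he_pos m hm)] at h1
    exact h1
  · intro m hm
    have h1 := hDN m hm
    have h2 := hgap1 m hm
    have h3 := hU m hm
    have h4 : (0 : ℝ) < D * U (m + 1) := by positivity
    have h5 := he_pos m hm
    refine ⟨by nlinarith, ?_⟩
    have hΔ : (0 : ℝ) ≤ τ (m + 1) - τ m := by nlinarith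
    have h6 : D * N (m + 1) * e (m + 1) ≤ 17 * (D * U (m + 1)) * e (m + 1) :=
      mul_le_mul_of_nonneg_right (by linarith) h5.le
    refine h6.trans ?_
    -- After squaring, `U * e² = l / 2` leaves the factor `17² / 18`, below the `32` of the gap
    -- condition.
    rw [← div_le_iff₀' (by norm_num : (0 : ℝ) < 3)]
    refine Real.le_sqrt_of_sq_le ?_
    have h7 : U (m + 1) * e (m + 1) ^ 2 = l / 2 := by
      simp only [U]; field_simp
    calc (17 * (D * U (m + 1)) * e (m + 1) / 3) ^ 2
        = 289 / 9 * D * (D * U (m + 1)) * (U (m + 1) * e (m + 1) ^ 2) := by ring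
      _ = 289 / 18 * (D * l) * (D * U (m + 1)) := by rw [h7]; ring
      _ ≤ D * l * (32 * D * U (m + 1)) := by
        have : 0 ≤ (D * l) * (D * U (m + 1)) := by positivity
        nlinarith
      _ ≤ D * l * (τ (m + 1) - τ m) := by gcongr

/-- Cauchy–Schwarz on `M + 1 ≤ 4M` gaps of total length `T`. -/
theorem sum_sqrt_le {M T : ℕ} (hM : 1 ≤ M) {τ : ℕ → ℕ} (h0 : τ 0 = 0) (hT : τ (M + 1) = T)
    (hmono : ∀ m ≤ M, τ m ≤ τ (m + 1)) :
    ∑ m ∈ Finset.range (M + 1), Real.sqrt ((τ (m + 1) : ℝ) - τ m) ≤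
      2 * Real.sqrt ((M : ℝ) * T) := by
  have hM' : (1 : ℝ) ≤ M := by exact_mod_cast hM
  have h1 := sq_sum_le_card_mul_sum_sq (s := Finset.range (M + 1))
    (f := fun m => Real.sqrt ((τ (m + 1) : ℝ) - τ m))
  have h2 : ∑ m ∈ Finset.range (M + 1), Real.sqrt ((τ (m + 1) : ℝ) - τ m) ^ 2 = T := by
    rw [Finset.sum_congr rfl fun m hm => Real.sq_sqrt (sub_nonneg.2 (by
      exact_mod_cast hmono m (Nat.lt_succ_iff.1 (Finset.mem_range.1 hm)))),
      Finset.sum_range_sub (fun m => (τ m : ℝ)), h0, hT]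
    simp
  rw [h2, Finset.card_range] at h1
  refine abs_le_of_sq_le_sq' ?_ (by positivity) |>.2
  refine h1.trans ?_
  rw [mul_pow, Real.sq_sqrt (by positivity)]
  push_cast
  have : (0 : ℝ) ≤ T := by positivity
  nlinarith

theorem MonitoringConsistent.one_le {T D : ℕ} {base : Strategy K}
    (h : MonitoringConsistent T D base) (env : Environment K) : 1 ≤ D := by
  by_contra! hD
  obtain rfl : D = 0 := by omega
  obtain ⟨ω, i, hi⟩ := (h env).exists
  simpa using hi 1 le_rfl (by omega)

end Bandit

end

/-! ### Assembly of the bound and choice of the constants. -/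

theorem mainTheorem1 (Cab c₀ : ℝ) (p : ℕ) :
    ∃ (c : ℝ) (q : ℕ), ∀ (K L D M T : ℕ) (base : Bandit.Strategy K) (env : Bandit.Environment K),
      1 ≤ L → L ≤ K → 1 ≤ M →
      Bandit.IsBanditAlgorithm L base →
      Bandit.HasDTRegret L T (c₀ * (1 + Real.log T) ^ p) base →
      Bandit.MonitoringConsistent T D base →
      Bandit.GloballyAbrupt env T D M Cab →
      MeasureTheory.Integrable
          (Bandit.regret env L (Bandit.adrBandit (1 / (T : ℝ) ^ 3) base) T)
          (Bandit.runMeasure env) ∧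
        Bandit.expectedRegret env L (Bandit.adrBandit (1 / (T : ℝ) ^ 3) base) T ≤
          c * (1 + Real.log T) ^ q *
            Real.sqrt (max 1 (max ((L : ℝ) * D / K) ((L : ℝ) * K / T))) *
            Real.sqrt ((M : ℝ) * L * K * T) := by
  refine ⟨2 * |c₀| * (2 + 9 * Cab) + 6, p + 1, ?_⟩
  intro K L D M T base env hL hLK hM halg hreg hmon hab
  refine ⟨Bandit.integrable_regret env env (halg.adrBandit _) T, ?_⟩
  have : Nonempty (Fin K) := ⟨⟨0, by omega⟩⟩
  obtain ⟨e, τ, N, hT2, hCab, hs, hjump, hN⟩ :=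
    Bandit.exists_schedule hab hM (hmon.one_le env)
  set l := Real.log ((T : ℝ) ^ 3) with hl
  set Λ := 1 + Real.log T with hΛ
  have hT0 : (0 : ℝ) < T := by exact_mod_cast (show 0 < T by omega)
  have hK0 : (0 : ℝ) < K := by exact_mod_cast (show 0 < K by omega)
  have hlog : Real.log 2 ≤ Real.log T := Real.log_le_log (by norm_num) (by exact_mod_cast hT2)
  have hlog2 := Real.log_two_gt_d9
  have hl3 : l = 3 * Real.log T := by rw [hl, Real.log_pow]; norm_num
  have hl2 : 2 ≤ l := by linarith
  have hΛ1 : 1 ≤ Λ := by linarith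
  have hlδ : Real.log (1 / (1 / (T : ℝ) ^ 3)) = l := by rw [one_div_one_div]
  set κ := max 1 (max ((L : ℝ) * D / K) ((L : ℝ) * K / T)) with hκ
  have hκ1 : 1 ≤ κ := le_max_left _ _
  have hκ2 : (L : ℝ) * D ≤ κ * K := by
    rw [← div_le_iff₀ hK0]; exact (le_max_left _ _).trans (le_max_right _ _)
  have hκ3 : (L : ℝ) * K ≤ κ * T := by
    rw [← div_le_iff₀ hT0]; exact (le_max_right _ _).trans (le_max_right _ _)
  set G := Real.sqrt κ * Real.sqrt (L * K) with hG
  have hG0 : 0 ≤ G := by positivity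
  have hgoal : Real.sqrt κ * Real.sqrt ((M : ℝ) * L * K * T) = G * Real.sqrt ((M : ℝ) * T) := by
    rw [show (M : ℝ) * L * K * T = L * K * (M * T) by ring,
      Real.sqrt_mul (show (0 : ℝ) ≤ L * K by positivity), hG, mul_assoc]
  -- The absolute value is needed because `c₀` may be negative.
  set C' := |c₀| * Λ ^ p with hC'
  have hC0 : 0 ≤ C' := by positivity
  have hCC : c₀ * Λ ^ p ≤ C' := mul_le_mul_of_nonneg_right (le_abs_self _) (by positivity)
  have hV := fun m hm r hr hr' => Bandit.expectedRegret_shift_le (L := L) hs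
    (J := fun m => Cab * e m) hjump (fun m hm => mul_nonneg hCab (hs.e_pos m hm).le) hreg hCC hC0
    (m := m) hm (r := r) hr hr'
  have hΔ : ∀ m ≤ M, (0 : ℝ) ≤ τ (m + 1) - τ m := fun m hm => by
    have := hs.delay_lt m hm
    rw [sub_nonneg]; exact_mod_cast (show τ m ≤ τ (m + 1) by omega)
  have hN' : ∀ m ≤ M, (D * N (m + 1) : ℝ) ≤ τ (m + 1) - τ m ∧
      D * N (m + 1) * (Cab * e (m + 1)) ≤
        Cab * (3 * Real.sqrt (D * l * (τ (m + 1) - τ m))) := by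
    intro m hm
    rcases hm.lt_or_eq with h | rfl
    · refine ⟨(hN m h).1, ?_⟩
      calc _ = Cab * (D * N (m + 1) * e (m + 1)) := by ring
        _ ≤ _ := mul_le_mul_of_nonneg_left (hN m h).2 hCab
    · have h2 := hΔ m le_rfl
      rw [hs.N_last]
      simp only [Nat.cast_zero, mul_zero, zero_mul]
      exact ⟨h2, by positivity⟩
  have hVle : ∀ m ≤ M, C' * (Real.sqrt (L * K * (τ (m + 1) - τ m + D * N (m + 1))) +
        L * (D * N (m + 1) * (Cab * e (m + 1)))) ≤
      C' * ((2 + 9 * Cab) * Λ) * G * Real.sqrt ((τ (m + 1) : ℝ) - τ m) := by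
    intro m hm
    obtain ⟨h1, h2⟩ := hN' m hm
    have h3 := hΔ m hm
    set Δ : ℝ := (τ (m + 1) : ℝ) - τ m
    have hLK0 : Real.sqrt (L * K) ≤ G :=
      le_mul_of_one_le_left (Real.sqrt_nonneg _) (Real.one_le_sqrt.2 hκ1)
    have e1 : Real.sqrt (L * K * (Δ + D * N (m + 1))) ≤ 2 * G * Real.sqrt Δ := by
      calc Real.sqrt (L * K * (Δ + D * N (m + 1))) ≤ Real.sqrt (2 ^ 2 * (L * K) * Δ) := by
            refine Real.sqrt_le_sqrt ?_
            have : (L * K : ℝ) * (Δ + D * N (m + 1)) ≤ L * K * (4 * Δ) := by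
              gcongr; linarith
            linarith
        _ = 2 * Real.sqrt (L * K) * Real.sqrt Δ := by
            rw [Real.sqrt_mul (by positivity), Real.sqrt_mul (by positivity),
              Real.sqrt_sq (by norm_num)]
        _ ≤ _ := by gcongr
    have e2 : L * Real.sqrt (D * l * Δ) ≤ 3 * Λ * G * Real.sqrt Δ := by
      -- The entry `LD/K` of `κ` is used here, as `L²D ≤ κLK`.
      have hD : L * Real.sqrt D ≤ G := by
        rw [hG, ← Real.sqrt_mul (by positivity)]
        refine Real.le_sqrt_of_sq_le ?_
        rw [mul_pow, Real.sq_sqrt (by positivity)]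
        nlinarith [mul_le_mul_of_nonneg_left hκ2 (Nat.cast_nonneg (α := ℝ) L)]
      have hsl : Real.sqrt l ≤ 3 * Λ := by
        refine Real.sqrt_le_iff.2 ⟨by linarith, ?_⟩
        nlinarith
      rw [Real.sqrt_mul (by positivity), Real.sqrt_mul (by positivity)]
      calc L * (Real.sqrt D * Real.sqrt l * Real.sqrt Δ)
          = (L * Real.sqrt D) * Real.sqrt l * Real.sqrt Δ := by ring
        _ ≤ G * (3 * Λ) * Real.sqrt Δ := by gcongr
        _ = _ := by ring
    have e3 : L * (D * N (m + 1) * (Cab * e (m + 1))) ≤ 9 * Cab * Λ * G * Real.sqrt Δ := by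
      calc L * (D * N (m + 1) * (Cab * e (m + 1)))
          ≤ L * (Cab * (3 * Real.sqrt (D * l * Δ))) :=
            mul_le_mul_of_nonneg_left h2 (Nat.cast_nonneg _)
        _ = 3 * Cab * (L * Real.sqrt (D * l * Δ)) := by ring
        _ ≤ 3 * Cab * (3 * Λ * G * Real.sqrt Δ) := by gcongr
        _ = _ := by ring
    have e4 : 2 * G * Real.sqrt Δ ≤ 2 * Λ * G * Real.sqrt Δ := by
      gcongr; linarith
    calc _ ≤ C' * (2 * Λ * G * Real.sqrt Δ + 9 * Cab * Λ * G * Real.sqrt Δ) :=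
          mul_le_mul_of_nonneg_left (by linarith) hC0
      _ = _ := by ring
  have hmain := Bandit.expectedRegret_adrBandit_le halg hs hlδ hl2 hmon
    (V := fun m => C' * ((2 + 9 * Cab) * Λ) * G * Real.sqrt ((τ (m + 1) : ℝ) - τ m))
    (fun m _ => by positivity) fun m hm r hr hr' => (hV m hm r hr hr').trans (hVle m hm)
  have hsum := Bandit.sum_sqrt_le hM hs.τ_zero hs.τ_last fun m hm => by
    have := hs.delay_lt m hm; omega
  -- The exceptional event costs exactly `2e * LK`, and `2e ≤ 6`. The entry `LK/T` of `κ` bounds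
  -- `LK` by `√(κLKT)`.
  have hbad : (L : ℝ) * T * (2 * K * T ^ 2 * Real.exp (-(l - 1))) ≤
      6 * (G * Real.sqrt ((M : ℝ) * T)) := by
    have h1 : Real.exp (-(l - 1)) = Real.exp 1 / T ^ 3 := by
      rw [show -(l - 1) = 1 - l by ring, Real.exp_sub, hl, Real.exp_log (by positivity)]
    have h2 : (L : ℝ) * T * (2 * K * T ^ 2 * Real.exp (-(l - 1))) =
        2 * Real.exp 1 * (L * K) := by
      rw [h1]; field_simp
    have h3 : (L : ℝ) * K ≤ G * Real.sqrt ((M : ℝ) * T) := by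
      rw [hG, ← Real.sqrt_mul (by positivity), ← Real.sqrt_mul (by positivity)]
      refine Real.le_sqrt_of_sq_le ?_
      have hM' : (1 : ℝ) ≤ M := by exact_mod_cast hM
      calc ((L : ℝ) * K) ^ 2 = L * K * (L * K) := by ring
        _ ≤ L * K * (κ * T) := by gcongr
        _ ≤ L * K * (κ * T) * M := le_mul_of_one_le_right (by positivity) hM'
        _ = _ := by ring
    rw [h2]
    have h4 := Real.exp_one_lt_d9
    have h5 : (0 : ℝ) ≤ L * K := by positivity
    nlinarith
  refine hmain.trans ?_
  rw [← Finset.mul_sum]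
  set X := G * Real.sqrt ((M : ℝ) * T) with hX
  have hX0 : 0 ≤ X := by positivity
  calc _ ≤ C' * ((2 + 9 * Cab) * Λ) * G * (2 * Real.sqrt ((M : ℝ) * T)) + 6 * X := by gcongr
    _ = 2 * |c₀| * (2 + 9 * Cab) * Λ ^ (p + 1) * X + 6 * 1 * X := by
        rw [hC', hX, pow_succ]; ring
    _ ≤ 2 * |c₀| * (2 + 9 * Cab) * Λ ^ (p + 1) * X + 6 * Λ ^ (p + 1) * X := by
        gcongr; exact one_le_pow₀ hΛ1
    _ = _ := by rw [mul_assoc _ (Real.sqrt κ), hgoal]; ring
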